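/- **Theorem (Ups and downs for positive cones).** *Conventions.* A partially ordered vector space is a real vector space $E$ with a partial ordering compatible with the linear structure; $E_+$ is its positive cone, and $\overline{E}=E\cup\{\infty\}$ is $E$ with a largest element adjoined, with the usual addition and action of $[0,\infty)$ on $\overline{E_+}=E_+\cup\{\infty\}$ (so $0\cdot\infty=0$). $E$ is *monotone complete* if every increasing net in $E$ that is bounded from above has a supremum. $E$ has the *countable sup property* if, whenever a net satisfies $0\le x_\lambda\uparrow x$ in $E$, there are countably many indices $\lambda_n$ with $x=\sup_n x_{\lambda_n}$. A map $I$ between partially ordered vector spaces *preserves the lattice structure* if, whenever $x\vee y$ exists, $I(x)\vee I(y)$ exists and equals $I(x\vee y)$. For a subset $S$ of a partially ordered set $P$, $S^{\Uparrow}$ (resp. $S^{\uparrow}$) is the set of all $x\in P$ such that $x_\lambda\uparrow x$ for some increasing net (resp. sequence) in $S$; $S^{\Downarrow}$ and $S^{\downarrow}$ are defined likewise with decreasing nets and sequences. Iterates are read from left to right, e.g. $S^{\uparrow\downarrow}=(S^{\uparrow})^{\downarrow}$. Let $E$ be monotone complete and let $\mathcal B$ be the Borel $\sigma$-algebra of a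 locally compact Hausdorff space $X$. A *measure* $\mu:\mathcal B\to\overline{E_+}$ satisfies $\mu(\emptyset)=0$ and $\mu(\bigcup_n A_n)=\bigvee_N\sum_{n\le N}\mu(A_n)$ in $\overline E$ for pairwise disjoint $A_n\in\mathcal B$; it is *finite* if $\mu(X)\in E$. It is *inner regular* at $A\in\mathcal B$ if $\mu(A)=\bigvee\{\mu(K):K\subseteq A\text{ compact}\}$, and *outer regular* at $A$ if $\mu(A)=\bigwedge\{\mu(V):V\supseteq A\text{ open}\}$, in $\overline E$. It is a *regular Borel measure* if $\mu(K)\in E$ for all compact $K$, $\mu$ is inner regular at all open sets, and $\mu$ is outer regular at all Borel sets. The order integral of an elementary function $\sum_i r_i\mathbf 1_{A_i}$ ($r_i\in[0,\infty)$, the $A_i\in\mathcal B$ pairwise disjoint) is $\sum_i r_i\mu(A_i)$; that of a measurable $f:X\to[0,\infty]$ is the supremum in $\overline{E}$ of the integrals of elementary functions $\varphi_n$ with $\varphi_n\uparrow f$ pointwise. $\mathcal L^1(\mu)$ is the space of measurable $f:X\to\mathbb R$ for which the integral of $|f|$ is finite, ordered pointwise; $I_\mu:\mathcal L^1(\mu)\to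 E$ is the resulting integral, defined by splitting $f$ into its positive and negative parts; and $\mathcal L^1(\mu)_+$ is the set of its nonnegative functions. $\mathrm L^1(\mu)$ is the quotient of $\mathcal L^1(\mu)$ modulo equality $\mu$-almost everywhere, with the induced ordering and the induced map $I_\mu:\mathrm L^1(\mu)\to E$; $\mathrm B(\mu)$ consists of the classes, modulo equality $\mu$-almost everywhere, of the bounded Borel measurable functions. The measure $\mu$ *represents* $T:\mathrm C_{\mathrm c}(X)\to E$ if $T(f)=I_\mu(f)$ for all $f\in \mathrm C_{\mathrm c}(X)$. For $f\in \mathrm C_{\mathrm c}(X)$, $f\prec V$ means $0\le f\le1$ and $\operatorname{supp}f\subseteq V$; $K\prec f$ means $0\le f\le 1$ and $f=1$ on $K$. *Hypotheses.* Let $X$ be a locally compact Hausdorff space, let $E$ be a monotone complete partially ordered vector space with the countable sup property, and let $T:\mathrm C_{\mathrm c}(X)\to E$ be a positive linear operator that is represented by a regular Borel measure $\mu:\mathcal B\to\overline{E_+}$ such that $$\mu(V)=\bigvee\{T(f):f\prec V\}\ \text{ for every open } V\subseteq X\text{ of finite measure},\qquad \mu(K)=\bigwedge\{T(f):K\prec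 f\}\ \text{ for every compact } K\subseteq X.$$ Suppose that $I_\mu:\mathcal L^1(\mu)\to E$ preserves the lattice structure. Write $T$ also for $I_\mu$ on $\mathcal L^1(\mu)$ and on $\mathrm L^1(\mu)$, and let $[\mathrm C_{\mathrm c}(X)_+]\subseteq \mathrm L^1(\mu)$ be the set of classes of the nonnegative elements of $\mathrm C_{\mathrm c}(X)$. Below, ups and downs of $[\mathrm C_{\mathrm c}(X)_+]$ are taken in $\mathrm L^1(\mu)$, and those of images of $T$ are taken in $E$. *Conclusions.* 1. $T(\mathcal L^1(\mu)_+)=T(\mathcal L^1(\mu)_+)^{\Uparrow}=T(\mathcal L^1(\mu)_+)^{\Downarrow}$ and $$T(\mathcal L^1(\mu)_+)=T([\mathrm C_{\mathrm c}(X)_+]^{\uparrow\downarrow\uparrow})=[T(\mathrm C_{\mathrm c}(X)_+)]^{\uparrow\downarrow\uparrow}.$$ 2. If $\mu$ is inner regular at all Borel sets of finite measure, then $$T(\mathcal L^1(\mu)_+)=T([\mathrm C_{\mathrm c}(X)_+]^{\downarrow\uparrow\downarrow})=[T(\mathrm C_{\mathrm c}(X)_+)]^{\downarrow\uparrow\downarrow},$$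 and even $$T(\mathcal L^1(\mu)_+)=T([\mathrm C_{\mathrm c}(X)_+]^{\downarrow\uparrow})=[T(\mathrm C_{\mathrm c}(X)_+)]^{\downarrow\uparrow}.$$ 3. If $\mu$ is finite and $\mathrm L^1(\mu)=\mathrm B(\mu)$, then $$T(\mathcal L^1(\mu)_+)=T([\mathrm C_{\mathrm c}(X)_+]^{\uparrow\downarrow})=[T(\mathrm C_{\mathrm c}(X)_+)]^{\uparrow\downarrow}.$$ -/

import Mathlib

open Set Filter MeasureTheory
open scoped NNReal ENNReal CompactlySupported

universe u

noncomputable section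

/-! ### Ups and downs, monotone completeness, the countable sup property

Nets in `α : Type u` are indexed by directed sets in `Type u`. This is no restriction: the range of
an increasing or decreasing net is a directed set in `α` with the same suprema and infima. -/

/-- `S^⇑`: the suprema of the increasing nets in `S`. -/
def netUp {α : Type u} [PartialOrder α] (S : Set α) : Set α :=
  {x | ∃ (ι : Type u) (_ : Preorder ι) (_ : Nonempty ι) (_ : IsDirected ι (· ≤ ·)) (u : ι → α),
    (∀ i, u i ∈ S) ∧ Monotone u ∧ IsLUB (range u) x}

/-- `S^⇓`: the infima of the decreasing nets in `S`. -/
def netDown {α : Type u} [PartialOrder α] (S : Set α) : Set α :=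
  {x | ∃ (ι : Type u) (_ : Preorder ι) (_ : Nonempty ι) (_ : IsDirected ι (· ≤ ·)) (u : ι → α),
    (∀ i, u i ∈ S) ∧ Antitone u ∧ IsGLB (range u) x}

/-- `S^↑`: the suprema of the increasing sequences in `S`. -/
def seqUp {α : Type u} [PartialOrder α] (S : Set α) : Set α :=
  {x | ∃ u : ℕ → α, (∀ n, u n ∈ S) ∧ Monotone u ∧ IsLUB (range u) x}

/-- `S^↓`: the infima of the decreasing sequences in `S`. -/
def seqDown {α : Type u} [PartialOrder α] (S : Set α) : Set α :=
  {x | ∃ u : ℕ → α, (∀ n, u n ∈ S) ∧ Antitone u ∧ IsGLB (range u) x}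

/-- Every increasing net that is bounded from above has a supremum. -/
def IsMonotoneComplete (E : Type u) [PartialOrder E] : Prop :=
  ∀ (ι : Type u) [Preorder ι] [Nonempty ι] [IsDirected ι (· ≤ ·)] (u : ι → E),
    Monotone u → BddAbove (range u) → ∃ x : E, IsLUB (range u) x

/-- Whenever `u i ↑ x` in the positive cone, `x` is the supremum of countably many of the `u i`. -/
def HasCountableSupProperty (E : Type u) [PartialOrder E] [Zero E] : Prop :=
  ∀ (ι : Type u) [Preorder ι] [Nonempty ι] [IsDirected ι (· ≤ ·)] (u : ι → E) (x : E),
    (∀ i, 0 ≤ u i) → Monotone u → IsLUB (range u) x →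
      ∃ k : ℕ → ι, IsLUB (range fun n => u (k n)) x

/-- Whenever `x ∨ y` exists, `T x ∨ T y` exists and equals `T (x ∨ y)`. -/
def PreservesLatticeStructure {α β : Type*} [PartialOrder α] [PartialOrder β] (T : α → β) : Prop :=
  ∀ x y z : α, IsLUB {x, y} z → IsLUB {T x, T y} (T z)

/-! ### Measures with values in the extended positive cone

`WithTop E` is `E` with a largest element `⊤ = ∞` adjoined. -/

/-- A measure with values in `E₊ ∪ {∞}`. Only its values on measurable sets matter. -/
structure OrderMeasure (X E : Type*) [MeasurableSpace X] [AddCommGroup E] [PartialOrder E] where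
  /-- The set function. -/
  toFun : Set X → WithTop E
  nonneg' : ∀ A, MeasurableSet A → 0 ≤ toFun A
  empty' : toFun ∅ = 0
  iUnion' : ∀ A : ℕ → Set X, (∀ n, MeasurableSet (A n)) → Pairwise (fun m n => Disjoint (A m) (A n)) →
    IsLUB (range fun N => ∑ n ∈ Finset.range N, toFun (A n)) (toFun (⋃ n, A n))

namespace OrderMeasure

variable {X E : Type*} [MeasurableSpace X] [AddCommGroup E] [PartialOrder E]

instance : CoeFun (OrderMeasure X E) (fun _ => Set X → WithTop E) := ⟨toFun⟩

theorem union_of_disjoint (μ : OrderMeasure X E) {A B : Set X} (hA : MeasurableSet A)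
    (hB : MeasurableSet B) (h : Disjoint A B) [IsOrderedAddMonoid E] : μ (A ∪ B) = μ A + μ B := by
  let C : ℕ → Set X := fun n => if n = 0 then A else if n = 1 then B else ∅
  have hC : ∀ n, MeasurableSet (C n) := by
    intro n
    dsimp only [C]
    split_ifs <;> simp_all
  have hd : Pairwise (fun m n => Disjoint (C m) (C n)) := by
    intro m n hmn
    dsimp only [C]
    split_ifs <;> simp_all [h.symm]
  have hU : (⋃ n, C n) = A ∪ B := by
    ext x
    simp only [mem_iUnion, mem_union]
    constructor
    · rintro ⟨n, hn⟩
      dsimp only [C] at hn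
      split_ifs at hn <;> simp_all
    · rintro (hx | hx)
      · exact ⟨0, by simpa [C] using hx⟩
      · exact ⟨1, by simpa [C] using hx⟩
  have key := μ.iUnion' C hC hd
  rw [hU] at key
  have hs : ∀ N, ∑ n ∈ Finset.range (N + 2), μ (C n) = μ A + μ B := by
    intro N
    induction N with
    | zero => simp [Finset.sum_range_succ, C]
    | succ k ih =>
      rw [Finset.sum_range_succ, ih]
      simp [C, μ.empty']
  refine key.unique ⟨?_, ?_⟩
  · rintro _ ⟨N, rfl⟩
    dsimp only
    rw [← hs N]
    exact Finset.sum_le_sum_of_subset_of_nonneg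
      (by intro x; simp only [Finset.mem_range]; omega) (fun i _ _ => μ.nonneg' _ (hC i))
  · intro b hb
    exact (hs 0) ▸ hb ⟨2, rfl⟩

theorem mono [IsOrderedAddMonoid E] (μ : OrderMeasure X E) {A B : Set X} (hA : MeasurableSet A)
    (hB : MeasurableSet B) (h : A ⊆ B) : μ A ≤ μ B := by
  have h1 := μ.union_of_disjoint hA (hB.diff hA) disjoint_sdiff_right
  rw [union_sdiff_cancel h] at h1
  rw [h1]
  exact le_add_of_nonneg_right (μ.nonneg' _ (hB.diff hA))

theorem union_null [IsOrderedAddMonoid E] (μ : OrderMeasure X E) {A B : Set X}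
    (hA : MeasurableSet A) (hB : MeasurableSet B) (h0 : μ A = 0) (h1 : μ B = 0) :
    μ (A ∪ B) = 0 := by
  rw [← union_sdiff_self, μ.union_of_disjoint hA (hB.diff hA) disjoint_sdiff_right, h0, zero_add]
  exact le_antisymm (h1 ▸ μ.mono (hB.diff hA) hB sdiff_subset) (μ.nonneg' _ (hB.diff hA))

theorem eq_of_eq_off_null [IsOrderedAddMonoid E] (μ : OrderMeasure X E) {A B N : Set X}
    (hA : MeasurableSet A) (hB : MeasurableSet B) (hN : MeasurableSet N) (h0 : μ N = 0)
    (h : A \ N = B \ N) : μ A = μ B := by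
  have key : ∀ C, MeasurableSet C → μ C = μ (C \ N) := by
    intro C hC
    have h1 := μ.union_of_disjoint (hC.diff hN) (hC.inter hN)
      (disjoint_sdiff_left.mono_right inter_subset_right)
    rw [sdiff_union_inter] at h1
    have h2 : μ (C ∩ N) = 0 := le_antisymm (h0 ▸ μ.mono (hC.inter hN) hN inter_subset_right)
      (μ.nonneg' _ (hC.inter hN))
    rw [h1, h2, add_zero]
  rw [key A hA, key B hB, h]

/-- The filter of the `μ`-almost everywhere valid properties. -/
def ae [IsOrderedAddMonoid E] (μ : OrderMeasure X E) : Filter X where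
  sets := {s | ∃ N, MeasurableSet N ∧ μ N = 0 ∧ Nᶜ ⊆ s}
  univ_sets := ⟨∅, MeasurableSet.empty, μ.empty', subset_univ _⟩
  sets_of_superset := by
    rintro s t ⟨N, hN, h0, hs⟩ hst
    exact ⟨N, hN, h0, hs.trans hst⟩
  inter_sets := by
    rintro s t ⟨N, hN, h0, hs⟩ ⟨M, hM, h1, ht⟩
    refine ⟨N ∪ M, hN.union hM, μ.union_null hN hM h0 h1, ?_⟩
    rw [compl_union]
    exact inter_subset_inter hs ht

/-! #### Finiteness and regularity -/

/-- `μ` is a finite measure. -/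
def IsFinite (μ : OrderMeasure X E) : Prop := μ univ ≠ ⊤

/-- Inner regularity at `A`; the supremum is taken in `E ∪ {∞}`. -/
def InnerRegularAt [TopologicalSpace X] (μ : OrderMeasure X E) (A : Set X) : Prop :=
  IsLUB {a | ∃ K, IsCompact K ∧ K ⊆ A ∧ μ K = a} (μ A)

/-- Outer regularity at `A`; the infimum is taken in `E ∪ {∞}`. -/
def OuterRegularAt [TopologicalSpace X] (μ : OrderMeasure X E) (A : Set X) : Prop :=
  IsGLB {a | ∃ V, IsOpen V ∧ A ⊆ V ∧ μ V = a} (μ A)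

/-- A regular Borel measure: finite on compact sets, inner regular at the open sets, and outer
regular at the Borel sets. -/
structure IsRegularBorel [TopologicalSpace X] (μ : OrderMeasure X E) : Prop where
  finite_compact : ∀ K, IsCompact K → μ K ≠ ⊤
  inner_open : ∀ V, IsOpen V → μ.InnerRegularAt V
  outer_borel : ∀ A, MeasurableSet A → μ.OuterRegularAt A

/-! #### The order integral -/

/-- The supremum of `S` in `E ∪ {∞}` (`⊤` if there is none; in a monotone complete space, an
increasing sequence in `E ∪ {∞}` always has a supremum). -/
def extSup (S : Set (WithTop E)) : WithTop E :=
  open Classical in if h : ∃ a, IsLUB S a then h.choose else ⊤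

/-- The action of `ℝ₊` on `E₊ ∪ {∞}`, with `0 · ∞ = 0` and `r · ∞ = ∞` for `r > 0`. -/
def extSMul [Module ℝ E] (r : ℝ≥0) (a : WithTop E) : WithTop E :=
  if r = 0 then 0 else a.map fun x => (r : ℝ) • x

/-- The order integral of an elementary function. -/
def elemIntegral [Module ℝ E] (μ : OrderMeasure X E) (φ : SimpleFunc X ℝ≥0) : WithTop E :=
  ∑ r ∈ φ.range, extSMul r (μ (φ ⁻¹' {r}))

/-- The order integral of a measurable function `f : X → [0, ∞]`: the supremum of the integrals of
a sequence of (finite valued) elementary functions that increases pointwise to `f`. The value does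
not depend on the sequence; Mathlib's canonical one is used. -/
def lintegral [Module ℝ E] (μ : OrderMeasure X E) (f : X → ℝ≥0∞) : WithTop E :=
  extSup (range fun n => μ.elemIntegral ((SimpleFunc.eapprox f n).map ENNReal.toNNReal))

/-- The space `𝓛¹(X, μ; ℝ)` of integrable functions, with its pointwise ordering. -/
def IntegrableFun [Module ℝ E] (μ : OrderMeasure X E) : Set (X → ℝ) :=
  {f | Measurable f ∧ μ.lintegral (fun x => ENNReal.ofReal |f x|) ≠ ⊤}

/-- The integral operator `I_μ : 𝓛¹(X, μ; ℝ) → E`. -/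
def integral [Module ℝ E] (μ : OrderMeasure X E) (f : μ.IntegrableFun) : E :=
  (μ.lintegral fun x => ENNReal.ofReal (f.1 x)).untopD 0 -
    (μ.lintegral fun x => ENNReal.ofReal (-f.1 x)).untopD 0

/-! #### The quotient spaces modulo equality almost everywhere -/

variable [IsOrderedAddMonoid E]

/-- `L¹(X, μ; ℝ)`, as a set of almost everywhere equality classes of functions. It is ordered by
the almost everywhere pointwise ordering. -/
def L1 [Module ℝ E] (μ : OrderMeasure X E) : Set (Germ μ.ae ℝ) :=
  {a | ∃ f : X → ℝ, f ∈ μ.IntegrableFun ∧ (f : Germ μ.ae ℝ) = a}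

/-- `B(X, μ; ℝ)`: the almost everywhere equality classes of bounded measurable functions. -/
def BoundedClasses (μ : OrderMeasure X E) : Set (Germ μ.ae ℝ) :=
  {a | ∃ f : X → ℝ, (Measurable f ∧ ∃ M : ℝ, ∀ x, |f x| ≤ M) ∧ (f : Germ μ.ae ℝ) = a}

/-- The quotient map from `𝓛¹(X, μ; ℝ)` to `L¹(X, μ; ℝ)`. -/
def toL1 [Module ℝ E] (μ : OrderMeasure X E) (f : μ.IntegrableFun) : μ.L1 :=
  ⟨(f.1 : Germ μ.ae ℝ), f.1, f.2, rfl⟩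

/-- The integral operator `I_μ : L¹(X, μ; ℝ) → E`, evaluated at a representative;
see `integralL1_toL1`. -/
def integralL1 [Module ℝ E] (μ : OrderMeasure X E) (a : μ.L1) : E :=
  μ.integral ⟨a.2.choose, a.2.choose_spec.1⟩

theorem elemIntegral_congr [Module ℝ E] (μ : OrderMeasure X E) {φ ψ : SimpleFunc X ℝ≥0} {N : Set X}
    (hN : MeasurableSet N) (h0 : μ N = 0) (h : ∀ x, x ∉ N → φ x = ψ x) :
    μ.elemIntegral φ = μ.elemIntegral ψ := by
  have key : ∀ (χ : SimpleFunc X ℝ≥0) (s : Finset ℝ≥0), χ.range ⊆ s →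
      μ.elemIntegral χ = ∑ r ∈ s, extSMul r (μ (χ ⁻¹' {r})) := by
    intro χ s hs
    refine Finset.sum_subset hs fun r _ hr => ?_
    rw [(SimpleFunc.preimage_eq_empty_iff χ r).2 hr, μ.empty', extSMul]
    split_ifs
    · rfl
    · exact congrArg WithTop.some (smul_zero _)
  rw [key φ _ Finset.subset_union_left, key ψ _ Finset.subset_union_right]
  refine Finset.sum_congr rfl fun r _ => ?_
  rw [μ.eq_of_eq_off_null (φ.measurableSet_fiber r) (ψ.measurableSet_fiber r) hN h0]
  ext x
  simp only [Set.mem_sdiff, mem_preimage, mem_singleton_iff]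
  constructor <;> rintro ⟨h1, h2⟩ <;> simp_all

theorem lintegral_congr [Module ℝ E] (μ : OrderMeasure X E) {f g : X → ℝ≥0∞}
    (hf : Measurable f) (hg : Measurable g) (h : f =ᶠ[μ.ae] g) : μ.lintegral f = μ.lintegral g := by
  obtain ⟨N, hN, h0, hs⟩ := h
  have key : ∀ n, μ.elemIntegral ((SimpleFunc.eapprox f n).map ENNReal.toNNReal) =
      μ.elemIntegral ((SimpleFunc.eapprox g n).map ENNReal.toNNReal) := by
    intro n
    refine μ.elemIntegral_congr hN h0 fun x hx => ?_
    have hfg : f x = g x := hs hx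
    simp only [SimpleFunc.map_apply, SimpleFunc.eapprox]
    rw [SimpleFunc.approx_apply x hf, SimpleFunc.approx_apply x hg, hfg]
  simp only [lintegral, key]

/-- The integral operator on the quotient is induced by that on `𝓛¹(X, μ; ℝ)`. -/
theorem integralL1_toL1 [Module ℝ E] (μ : OrderMeasure X E) (f : μ.IntegrableFun) :
    μ.integralL1 (μ.toL1 f) = μ.integral f := by
  have h1 := (μ.toL1 f).2.choose_spec
  have h2 : (μ.toL1 f).2.choose =ᶠ[μ.ae] f.1 := Germ.coe_eq.1 h1.2
  have h3 : Measurable (μ.toL1 f).2.choose := h1.1.1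
  have h4 : Measurable f.1 := f.2.1
  have e1 := μ.lintegral_congr (ENNReal.measurable_ofReal.comp h3)
    (ENNReal.measurable_ofReal.comp h4) (h2.fun_comp ENNReal.ofReal)
  have e2 := μ.lintegral_congr (ENNReal.measurable_ofReal.comp h3.neg)
    (ENNReal.measurable_ofReal.comp h4.neg) (h2.fun_comp fun t => ENNReal.ofReal (-t))
  exact congrArg₂ (fun a b : WithTop E => a.untopD 0 - b.untopD 0) e1 e2

end OrderMeasure

/-! ### Representing measures -/

/-- `f ≺ V`. -/
def SubordinateToOpen {X : Type*} [TopologicalSpace X] (f : C_c(X, ℝ)) (V : Set X) : Prop :=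
  (∀ x, 0 ≤ f x ∧ f x ≤ 1) ∧ tsupport f ⊆ V

/-- `K ≺ f`. -/
def DominatesCompact {X : Type*} [TopologicalSpace X] (K : Set X) (f : C_c(X, ℝ)) : Prop :=
  (∀ x, 0 ≤ f x ∧ f x ≤ 1) ∧ ∀ x ∈ K, f x = 1

/-- `μ` represents `T`: each `f` in `C_c(X)` is integrable, with integral `T f`. -/
def OrderMeasure.Represents {X E : Type*} [TopologicalSpace X] [MeasurableSpace X] [AddCommGroup E]
    [PartialOrder E] [Module ℝ E] (μ : OrderMeasure X E) (T : C_c(X, ℝ) → E) : Prop :=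
  ∀ f : C_c(X, ℝ), ∃ h : (f : X → ℝ) ∈ μ.IntegrableFun, μ.integral ⟨f, h⟩ = T f

/-- `[C_c(X)₊]`: the classes in `L¹(X, μ; ℝ)` of the positive functions in `C_c(X)`. -/
def OrderMeasure.posCcClasses {X E : Type*} [TopologicalSpace X] [MeasurableSpace X]
    [AddCommGroup E] [PartialOrder E] [IsOrderedAddMonoid E] [Module ℝ E] (μ : OrderMeasure X E) :
    Set μ.L1 :=
  {a | ∃ f : C_c(X, ℝ), 0 ≤ f ∧ ((f : X → ℝ) : Germ μ.ae ℝ) = a.1}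

/-- `I_μ(𝓛¹(X, μ; ℝ₊))`. -/
def OrderMeasure.integralPosCone {X E : Type*} [MeasurableSpace X]
    [AddCommGroup E] [PartialOrder E] [Module ℝ E] (μ : OrderMeasure X E) : Set E :=
  μ.integral '' {f | ∀ x, 0 ≤ f.1 x}

end

noncomputable section

/-! ### Monotone complete spaces and suprema in `E ∪ {∞}` -/

section Order

variable {E : Type u} [PartialOrder E]

/-! Write P for the image of the cone 𝓛¹₊ under the integral. Each identity in the conclusion comes
from a circle of three inclusions: P is contained in the integrals of some ups and downs of
[C_c(X)₊]; these lie in the same ups and downs of T(C_c(X)₊) because the integral on L¹ respects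
monotone sequential limits (`isLUB_integralL1`, `isGLB_integralL1`); and the latter lie in P because
P is closed under sequential ups and downs.

The closedness of P is where preservation of the lattice structure enters. If the integrals of f₀,
f₁, … increase, the fₙ themselves need not, but f₀ ∨ … ∨ fₙ has the same integral as fₙ
(`realIntegral_partialSups`), so monotone convergence yields a function whose integral is the
supremum. Nets reduce to sequences by the countable sup property.

The first inclusion is an approximation of functions. The order integral is strictly positive: a
nonnegative function with integral zero vanishes almost everywhere. Hence an increasing sequence
below g whose integrals have supremum ∫ g converges to g almost everywhere (`tendsto_of_isLUB`).
Combined with the countable sup property, this turns the formulas for μ(V) and μ(K) and the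
regularity of μ, which are statements about suprema and infima in E, into almost everywhere monotone
sequences: 1_V is an up of C_c(X)₊ for open V of finite measure, 1_K is a down for compact K, and
1_A is an up-down by outer regularity, or a down-up where inner regularity holds. These classes are
stable under sums and nonnegative multiples, so they contain the nonnegative integrable elementary
functions, and every f in 𝓛¹₊ is an up of those. Stability under max or min merges two consecutive
ups or downs into one (`aeUp_aeUp_subset`, `aeDown_aeDown_subset`). For finite μ, a bounded f is
also a down of elementary functions.

The underlying integration theory rests on an Archimedean property that is automatic in a monotone
complete space (`nonpos_of_forall_le_smul`). -/

theorem IsMonotoneComplete.exists_isLUB_nat (hE : IsMonotoneComplete E) {u : ℕ → E}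
    (hu : Monotone u) (hb : BddAbove (range u)) : ∃ x, IsLUB (range u) x := by
  -- Nets are indexed in the universe of `E`, so ℕ has to be lifted into it.
  have hr : range (fun n : ULift.{u} ℕ => u n.down) = range u :=
    (ULift.down_surjective (α := ℕ)).range_comp u
  obtain ⟨x, hx⟩ := hE (ULift.{u} ℕ) (fun n => u n.down) (fun m n h => hu h) (by rwa [hr])
  exact ⟨x, hr ▸ hx⟩

theorem isLUB_range_coe_withTop {ι : Sort*} {u : ι → E} {x : E} :
    IsLUB (range fun i => (u i : WithTop E)) (x : WithTop E) ↔ IsLUB (range u) x := by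
  constructor
  · rintro ⟨h1, h2⟩
    refine ⟨?_, fun b hb => ?_⟩
    · rintro _ ⟨i, rfl⟩
      exact WithTop.coe_le_coe.1 (h1 ⟨i, rfl⟩)
    · refine WithTop.coe_le_coe.1 (h2 ?_)
      rintro _ ⟨i, rfl⟩
      exact WithTop.coe_le_coe.2 (hb ⟨i, rfl⟩)
  · rintro ⟨h1, h2⟩
    refine ⟨?_, fun b hb => ?_⟩
    · rintro _ ⟨i, rfl⟩
      exact WithTop.coe_le_coe.2 (h1 ⟨i, rfl⟩)
    · induction b using WithTop.recTopCoe with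
      | top => exact le_top
      | coe b =>
        refine WithTop.coe_le_coe.2 (h2 ?_)
        rintro _ ⟨i, rfl⟩
        exact WithTop.coe_le_coe.1 (hb ⟨i, rfl⟩)

theorem IsMonotoneComplete.exists_isLUB_withTop (hE : IsMonotoneComplete E) {u : ℕ → WithTop E}
    (hu : Monotone u) : ∃ x, IsLUB (range u) x := by
  by_cases h : ∃ b : E, (b : WithTop E) ∈ upperBounds (range u)
  · obtain ⟨b, hb⟩ := h
    have hn : ∀ n, u n ≠ ⊤ := fun n => ((hb ⟨n, rfl⟩).trans_lt (WithTop.coe_lt_top b)).ne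
    lift u to ℕ → E using hn
    obtain ⟨x, hx⟩ := hE.exists_isLUB_nat (u := u)
      (fun m n h => WithTop.coe_le_coe.1 (hu h)) ⟨b, by
        rintro _ ⟨n, rfl⟩
        exact WithTop.coe_le_coe.1 (hb ⟨n, rfl⟩)⟩
    exact ⟨x, isLUB_range_coe_withTop.2 hx⟩
  · refine ⟨⊤, fun _ _ => le_top, fun b hb => ?_⟩
    induction b using WithTop.recTopCoe with
    | top => exact le_rfl
    | coe b => exact absurd ⟨b, hb⟩ h

end Order

/-! ### Sums of suprema, and the Archimedean property -/

section OrderedGroup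

variable {E : Type u} [AddCommGroup E] [PartialOrder E] [IsOrderedAddMonoid E]

theorem isGLB_range_iff_isLUB_neg {ι : Sort*} {a : ι → E} {x : E} :
    IsGLB (range a) x ↔ IsLUB (range fun i => -a i) (-x) := by
  rw [show (range fun i => -a i) = -range a by
    rw [← image_neg_eq_neg, ← range_comp]; rfl]
  exact isLUB_neg'.symm

theorem isLUB_range_add {a b : ℕ → E} {x y : E} (ha : Monotone a) (hb : Monotone b)
    (hx : IsLUB (range a) x) (hy : IsLUB (range b) y) : IsLUB (range fun n => a n + b n) (x + y) := by
  refine ⟨?_, fun c hc => ?_⟩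
  · rintro _ ⟨n, rfl⟩
    exact add_le_add (hx.1 ⟨n, rfl⟩) (hy.1 ⟨n, rfl⟩)
  · have key : ∀ m n, a m + b n ≤ c := fun m n =>
      (add_le_add (ha (le_max_left m n)) (hb (le_max_right m n))).trans (hc ⟨max m n, rfl⟩)
    have h1 : ∀ n, x ≤ c - b n := fun n => hx.2 (by
      rintro _ ⟨m, rfl⟩
      exact le_sub_iff_add_le.2 (key m n))
    have h2 : y ≤ c - x := hy.2 (by
      rintro _ ⟨n, rfl⟩
      exact le_sub_comm.1 (h1 n))
    rw [add_comm]
    exact le_sub_iff_add_le.1 h2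

theorem isLUB_range_add_withTop {a b : ℕ → WithTop E} {x y : WithTop E} (ha : Monotone a)
    (hb : Monotone b) (ha0 : ∀ n, 0 ≤ a n) (hb0 : ∀ n, 0 ≤ b n)
    (hx : IsLUB (range a) x) (hy : IsLUB (range b) y) :
    IsLUB (range fun n => a n + b n) (x + y) := by
  refine ⟨?_, fun c hc => ?_⟩
  · rintro _ ⟨n, rfl⟩
    exact add_le_add (hx.1 ⟨n, rfl⟩) (hy.1 ⟨n, rfl⟩)
  · induction c using WithTop.recTopCoe with
    | top => exact le_top
    | coe c =>
      -- Nonnegativity lets a finite bound on the sums bound each summand, so that everything takes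
      -- place in `E`.
      have h1 : x ≤ c := hx.2 (by
        rintro _ ⟨n, rfl⟩
        exact (le_add_of_nonneg_right (hb0 n)).trans (hc ⟨n, rfl⟩))
      have h2 : y ≤ c := hy.2 (by
        rintro _ ⟨n, rfl⟩
        exact (le_add_of_nonneg_left (ha0 n)).trans (hc ⟨n, rfl⟩))
      have hxt := (h1.trans_lt (WithTop.coe_lt_top c)).ne
      have hyt := (h2.trans_lt (WithTop.coe_lt_top c)).ne
      have han : ∀ n, a n ≠ ⊤ := fun n => ((hx.1 ⟨n, rfl⟩).trans_lt hxt.lt_top).ne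
      have hbn : ∀ n, b n ≠ ⊤ := fun n => ((hy.1 ⟨n, rfl⟩).trans_lt hyt.lt_top).ne
      lift x to E using hxt
      lift y to E using hyt
      lift a to ℕ → E using han
      lift b to ℕ → E using hbn
      have := isLUB_range_coe_withTop.2 (isLUB_range_add (fun m n h => WithTop.coe_le_coe.1 (ha h))
        (fun m n h => WithTop.coe_le_coe.1 (hb h)) (isLUB_range_coe_withTop.1 hx)
        (isLUB_range_coe_withTop.1 hy))
      exact this.2 (by
        rintro _ ⟨n, rfl⟩
        exact hc ⟨n, rfl⟩)

theorem isLUB_range_finset_sum_withTop {ι : Type*} (s : Finset ι) {a : ι → ℕ → WithTop E}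
    {x : ι → WithTop E} (ha : ∀ i, Monotone (a i)) (h0 : ∀ i n, 0 ≤ a i n)
    (hx : ∀ i, IsLUB (range (a i)) (x i)) :
    IsLUB (range fun n => ∑ i ∈ s, a i n) (∑ i ∈ s, x i) := by
  classical
  induction s using Finset.induction_on with
  | empty => simp
  | insert i s hi ih =>
    simp only [Finset.sum_insert hi]
    exact isLUB_range_add_withTop (ha i)
      (fun m n h => Finset.sum_le_sum fun j _ => ha j h) (h0 i)
      (fun n => Finset.sum_nonneg fun j _ => h0 j n) (hx i) ih

variable [Module ℝ E]

/-- The sequence vₙ = -2⁻ⁿx increases and is bounded by 0, so it has a supremum z. As vₙ = 2vₙ₊₁ ≤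
2z, also z ≤ 2z, that is, z ≥ 0. On the other hand all vₙ ≤ -y, so 0 ≤ z ≤ -y. -/
theorem IsMonotoneComplete.nonpos_of_forall_le_smul [IsOrderedModule ℝ E]
    (hE : IsMonotoneComplete E) {x y : E} (hx : 0 ≤ x) (h : ∀ t : ℝ, 0 < t → y ≤ t • x) :
    y ≤ 0 := by
  let v : ℕ → E := fun n => -(((2 : ℝ) ^ n)⁻¹ • x)
  have hv : Monotone v := by
    refine fun m n hmn => neg_le_neg (smul_le_smul_of_nonneg_right ?_ hx)
    gcongr
    norm_num
  have hv2 : ∀ n, v (n + 1) + v (n + 1) = v n := by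
    intro n
    simp only [v]
    rw [← neg_add, ← add_smul, pow_succ]
    congr 2
    field_simp
    norm_num
  have hv0 : ∀ n, v n ≤ 0 := fun n => neg_nonpos.2 (smul_nonneg (by positivity) hx)
  obtain ⟨z, hz⟩ := hE.exists_isLUB_nat hv ⟨0, by rintro _ ⟨n, rfl⟩; exact hv0 n⟩
  have h1 : z ≤ z + z := hz.2 (by
    rintro _ ⟨n, rfl⟩
    rw [← hv2 n]
    exact add_le_add (hz.1 ⟨_, rfl⟩) (hz.1 ⟨_, rfl⟩))
  have h2 : 0 ≤ z := nonneg_of_le_add_right h1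
  have h3 : z ≤ -y := hz.2 (by
    rintro _ ⟨n, rfl⟩
    exact neg_le_neg (h _ (by positivity)))
  exact neg_nonneg.1 (h2.trans h3)

end OrderedGroup

namespace OrderMeasure

/-! ### The action of [0,∞) on E ∪ {∞} -/

section ExtSMul

variable {E : Type u} [AddCommGroup E] [Module ℝ E]

theorem extSMul_zero_left (a : WithTop E) : extSMul 0 a = 0 := if_pos rfl

theorem extSMul_zero_right (r : ℝ≥0) : extSMul r (0 : WithTop E) = 0 := by
  unfold extSMul
  split_ifs
  · rfl
  · exact congrArg WithTop.some (smul_zero _)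

theorem extSMul_coe (r : ℝ≥0) (x : E) : extSMul r (x : WithTop E) = ((r : ℝ) • x : E) := by
  unfold extSMul
  split_ifs with h
  · simp [h]
  · rfl

theorem extSMul_top {r : ℝ≥0} (hr : r ≠ 0) : extSMul r (⊤ : WithTop E) = ⊤ := if_neg hr

theorem extSMul_one (a : WithTop E) : extSMul 1 a = a := by
  induction a using WithTop.recTopCoe with
  | top => exact extSMul_top one_ne_zero
  | coe a => simp [extSMul_coe]

theorem extSMul_add_left (r s : ℝ≥0) (a : WithTop E) :
    extSMul (r + s) a = extSMul r a + extSMul s a := by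
  induction a using WithTop.recTopCoe with
  | top =>
    rcases eq_or_ne r 0 with rfl | hr
    · simp [extSMul_zero_left]
    · rw [extSMul_top hr, extSMul_top (by positivity), WithTop.top_add]
  | coe a => simp only [extSMul_coe, NNReal.coe_add, add_smul, WithTop.coe_add]

theorem extSMul_add_right (r : ℝ≥0) (a b : WithTop E) :
    extSMul r (a + b) = extSMul r a + extSMul r b := by
  rcases eq_or_ne r 0 with rfl | hr
  · simp [extSMul_zero_left]
  induction a using WithTop.recTopCoe with
  | top => rw [WithTop.top_add, extSMul_top hr, WithTop.top_add]
  | coe a =>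
    induction b using WithTop.recTopCoe with
    | top => rw [WithTop.add_top, extSMul_top hr, WithTop.add_top]
    | coe b =>
      rw [← WithTop.coe_add]
      rw [extSMul_coe, extSMul_coe, extSMul_coe, smul_add, WithTop.coe_add]

theorem extSMul_mul (r s : ℝ≥0) (a : WithTop E) :
    extSMul (r * s) a = extSMul r (extSMul s a) := by
  rcases eq_or_ne r 0 with rfl | hr
  · simp [extSMul_zero_left]
  rcases eq_or_ne s 0 with rfl | hs
  · simp [extSMul_zero_left, extSMul_zero_right]
  induction a using WithTop.recTopCoe with
  | top => rw [extSMul_top hs, extSMul_top hr, extSMul_top (mul_ne_zero hr hs)]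
  | coe a => simp only [extSMul_coe, NNReal.coe_mul, mul_smul]

theorem extSMul_sum {ι : Type*} (r : ℝ≥0) (s : Finset ι) (a : ι → WithTop E) :
    extSMul r (∑ i ∈ s, a i) = ∑ i ∈ s, extSMul r (a i) := by
  classical
  induction s using Finset.induction_on with
  | empty => exact extSMul_zero_right r
  | insert i s hi ih => rw [Finset.sum_insert hi, Finset.sum_insert hi, extSMul_add_right, ih]

variable [PartialOrder E] [IsOrderedModule ℝ E]

theorem extSMul_mono (r : ℝ≥0) {a b : WithTop E} (h : a ≤ b) : extSMul r a ≤ extSMul r b := by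
  rcases eq_or_ne r 0 with rfl | hr
  · simp [extSMul_zero_left]
  induction b using WithTop.recTopCoe with
  | top => simp [extSMul_top hr]
  | coe b =>
    lift a to E using (h.trans_lt (WithTop.coe_lt_top b)).ne
    rw [extSMul_coe, extSMul_coe, WithTop.coe_le_coe]
    exact smul_le_smul_of_nonneg_left (WithTop.coe_le_coe.1 h) r.2

theorem extSMul_nonneg (r : ℝ≥0) {a : WithTop E} (h : 0 ≤ a) : 0 ≤ extSMul r a :=
  (extSMul_zero_right r).symm.le.trans (extSMul_mono r h)

theorem extSMul_le_iff {r : ℝ≥0} (hr : r ≠ 0) {a b : WithTop E} :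
    extSMul r a ≤ b ↔ a ≤ extSMul r⁻¹ b := by
  constructor <;> intro h
  · simpa [← extSMul_mul, inv_mul_cancel₀ hr, extSMul_one] using extSMul_mono r⁻¹ h
  · simpa [← extSMul_mul, mul_inv_cancel₀ hr, extSMul_one] using extSMul_mono r h

theorem isLUB_range_extSMul (r : ℝ≥0) {a : ℕ → WithTop E} {x : WithTop E}
    (hx : IsLUB (range a) x) : IsLUB (range fun n => extSMul r (a n)) (extSMul r x) := by
  rcases eq_or_ne r 0 with rfl | hr
  · simp [extSMul_zero_left]
  refine ⟨?_, fun c hc => ?_⟩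
  · rintro _ ⟨n, rfl⟩
    exact extSMul_mono r (hx.1 ⟨n, rfl⟩)
  · rw [extSMul_le_iff hr]
    refine hx.2 ?_
    rintro _ ⟨n, rfl⟩
    exact (extSMul_le_iff hr).1 (hc ⟨n, rfl⟩)

end ExtSMul

/-! ### The integral of elementary functions -/

section Elementary

variable {X : Type*} {E : Type u} [MeasurableSpace X] [AddCommGroup E] [PartialOrder E]
  [IsOrderedAddMonoid E] (μ : OrderMeasure X E)

/-- Continuity from below: the successive differences are disjoint and their partial sums telescope.
-/
theorem isLUB_range_of_monotone {A : ℕ → Set X} (hA : ∀ n, MeasurableSet (A n))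
    (hm : Monotone A) : IsLUB (range fun n => μ (A n)) (μ (⋃ n, A n)) := by
  have hd : ∀ n, MeasurableSet (disjointed A n) := fun n => MeasurableSet.disjointed hA n
  have key := μ.iUnion' (disjointed A) hd (disjoint_disjointed A)
  rw [iUnion_disjointed] at key
  have hs : ∀ N, ∑ n ∈ Finset.range (N + 1), μ (disjointed A n) = μ (A N) := by
    intro N
    induction N with
    | zero => simp
    | succ k ih =>
      rw [Finset.sum_range_succ, ih, hm.disjointed_add_one,
        ← μ.union_of_disjoint (hA k) ((hA _).diff (hA k)) disjoint_sdiff_right,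
        union_sdiff_cancel (hm (Nat.le_add_right k 1))]
  refine ⟨?_, fun b hb => key.2 ?_⟩
  · rintro _ ⟨n, rfl⟩
    exact μ.mono (hA n) (MeasurableSet.iUnion hA) (subset_iUnion A n)
  · rintro _ ⟨N, rfl⟩
    refine le_trans ?_ (hb ⟨N, rfl⟩)
    dsimp only
    rw [← hs N]
    exact Finset.sum_le_sum_of_subset_of_nonneg
      (by intro x; simp only [Finset.mem_range]; omega) (fun i _ _ => μ.nonneg' _ (hd i))

theorem sum_inter_fiber {β : Type*} (χ : SimpleFunc X β) {A : Set X} (hA : MeasurableSet A)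
    (t : Finset β) (ht : χ.range ⊆ t) : ∑ b ∈ t, μ (A ∩ χ ⁻¹' {b}) = μ A := by
  classical
  have key : ∀ s : Finset β, ∑ b ∈ s, μ (A ∩ χ ⁻¹' {b}) = μ (A ∩ χ ⁻¹' s) := by
    intro s
    induction s using Finset.induction_on with
    | empty => simp [μ.empty']
    | insert b s hb ih =>
      rw [Finset.sum_insert hb, ih, ← μ.union_of_disjoint (hA.inter (χ.measurableSet_fiber b))
        (hA.inter (χ.measurableSet_preimage _)), ← inter_union_distrib_left, ← preimage_union,
        Finset.coe_insert, insert_eq]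
      refine Disjoint.mono inter_subset_right inter_subset_right (Disjoint.preimage _ ?_)
      simpa using hb
  rw [key, inter_eq_left.2]
  exact fun x _ => ht (χ.mem_range_self x)

variable [Module ℝ E]

/-- The integral may be computed on any finite measurable partition on whose pieces the function is
constant, not only on its own level sets. Applied to pairs, this gives common refinements. -/
theorem elemIntegral_map {β : Type*} (χ : SimpleFunc X β) (g : β → ℝ≥0)
    (t : Finset β) (ht : χ.range ⊆ t) :
    μ.elemIntegral (χ.map g) = ∑ b ∈ t, extSMul (g b) (μ (χ ⁻¹' {b})) := by
  classical
  rw [elemIntegral]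
  have h1 : ∀ c ∈ (χ.map g).range, extSMul c (μ ((χ.map g) ⁻¹' {c})) =
      ∑ b ∈ t, extSMul c (μ ((χ.map g) ⁻¹' {c} ∩ χ ⁻¹' {b})) := by
    intro c _
    rw [← extSMul_sum, μ.sum_inter_fiber χ (SimpleFunc.measurableSet_fiber _ _) t ht]
  -- After the exchange of sums, only the term c = g b survives for each b; the other intersections
  -- are empty.
  rw [Finset.sum_congr rfl h1, Finset.sum_comm]
  refine Finset.sum_congr rfl fun b _ => ?_
  rw [Finset.sum_eq_single (g b)]
  · congr 2
    ext x
    simp +contextual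
  · intro c _ hc
    rw [show (χ.map g) ⁻¹' {c} ∩ χ ⁻¹' {b} = ∅ by
      ext x
      simp only [SimpleFunc.coe_map, mem_inter_iff, mem_preimage, Function.comp_apply,
        mem_singleton_iff, mem_empty_iff_false, iff_false, not_and]
      rintro h rfl
      exact hc h.symm, μ.empty', extSMul_zero_right]
  · intro hb
    rw [show χ ⁻¹' {b} = ∅ by
      ext x
      simp only [mem_preimage, mem_singleton_iff, mem_empty_iff_false, iff_false]
      rintro rfl
      exact hb ((χ.map g).mem_range_self x), inter_empty, μ.empty', extSMul_zero_right]

theorem elemIntegral_add (φ ψ : SimpleFunc X ℝ≥0) :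
    μ.elemIntegral (φ + ψ) = μ.elemIntegral φ + μ.elemIntegral ψ := by
  have h1 := μ.elemIntegral_map (φ.pair ψ) (fun b => b.1 + b.2) _ subset_rfl
  have h2 := μ.elemIntegral_map (φ.pair ψ) Prod.fst _ subset_rfl
  have h3 := μ.elemIntegral_map (φ.pair ψ) Prod.snd _ subset_rfl
  simp only [extSMul_add_left, Finset.sum_add_distrib] at h1
  rw [← h2, ← h3] at h1
  exact h1

theorem elemIntegral_smul (t : ℝ≥0) (φ : SimpleFunc X ℝ≥0) :
    μ.elemIntegral (φ.map (t * ·)) = extSMul t (μ.elemIntegral φ) := by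
  rw [μ.elemIntegral_map φ _ _ subset_rfl, elemIntegral]
  simp only [extSMul_mul, extSMul_sum]

/-- The index set of the sum does not depend on `A`, so a supremum over increasing sets `A` can be
taken term by term. The proof tags the values of `φ` with a Boolean for membership of `A`. -/
theorem elemIntegral_restrict (φ : SimpleFunc X ℝ≥0) {A : Set X} (hA : MeasurableSet A) :
    μ.elemIntegral (φ.restrict A) = ∑ r ∈ φ.range, extSMul r (μ (φ ⁻¹' {r} ∩ A)) := by
  classical
  let χ : SimpleFunc X (ℝ≥0 × Bool) :=
    φ.pair (SimpleFunc.piecewise A hA (SimpleFunc.const X true) (SimpleFunc.const X false))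
  have h1 := μ.elemIntegral_map χ (fun b => if b.2 then b.1 else 0) (φ.range ×ˢ Finset.univ) (by
    intro b hb
    obtain ⟨x, rfl⟩ := SimpleFunc.mem_range.1 hb
    exact Finset.mem_product.2 ⟨φ.mem_range_self x, Finset.mem_univ _⟩)
  have h2 : χ.map (fun b => if b.2 then b.1 else 0) = φ.restrict A := by
    ext x
    by_cases hx : x ∈ A <;> simp [χ, SimpleFunc.restrict_apply _ hA, hx]
  rw [h2, Finset.sum_product] at h1
  rw [h1]
  refine Finset.sum_congr rfl fun r _ => ?_
  simp only [Fintype.sum_bool, if_true, Bool.false_eq_true, if_false, extSMul_zero_left, add_zero]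
  congr 2
  ext x
  by_cases hx : x ∈ A <;> simp [χ, hx]

theorem elemIntegral_restrict_const (c : ℝ≥0) {A : Set X} (hA : MeasurableSet A) :
    μ.elemIntegral ((SimpleFunc.const X c).restrict A) = extSMul c (μ A) := by
  rw [elemIntegral_restrict _ _ hA]
  cases isEmpty_or_nonempty X
  · have : A = ∅ := Subsingleton.elim _ _
    simp [this, μ.empty', extSMul_zero_right]
  · rw [SimpleFunc.range_const, Finset.sum_singleton, SimpleFunc.coe_const]
    congr 2
    ext x
    simp

variable [IsOrderedModule ℝ E]

theorem elemIntegral_nonneg (φ : SimpleFunc X ℝ≥0) : 0 ≤ μ.elemIntegral φ :=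
  Finset.sum_nonneg fun _ _ => extSMul_nonneg _ (μ.nonneg' _ (φ.measurableSet_fiber _))

theorem elemIntegral_mono {φ ψ : SimpleFunc X ℝ≥0} (h : φ ≤ ψ) :
    μ.elemIntegral φ ≤ μ.elemIntegral ψ := by
  have : ψ = φ + (ψ - φ) := by
    ext x
    simp [add_tsub_cancel_of_le (h x)]
  rw [this, elemIntegral_add]
  exact le_add_of_nonneg_right (μ.elemIntegral_nonneg _)

/-- If the integrals of all elementary functions below some member of an increasing sequence are
bounded by `S`, then so are those of all elementary functions below its supremum. -/
theorem elemIntegral_le_of_le_iSup (hE : IsMonotoneComplete E) {f : ℕ → X → ℝ≥0∞}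
    (hf : ∀ n, Measurable (f n)) (hm : Monotone f) {S : WithTop E}
    (hS : ∀ n (φ : SimpleFunc X ℝ≥0), (∀ x, (φ x : ℝ≥0∞) ≤ f n x) → μ.elemIntegral φ ≤ S)
    (ψ : SimpleFunc X ℝ≥0) (hψ : ∀ x, (ψ x : ℝ≥0∞) ≤ ⨆ n, f n x) : μ.elemIntegral ψ ≤ S := by
  -- Shrinking `ψ` by t < 1 makes the inequality strict where ψ ≠ 0, so the sets A n on which tψ ≤
  -- fₙ increase to the whole space, and the integrals of tψ restricted to A n increase to that of
  -- tψ.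
  have key : ∀ t : ℝ≥0, t < 1 → extSMul t (μ.elemIntegral ψ) ≤ S := by
    intro t ht
    rw [← elemIntegral_smul]
    set χ := ψ.map (t * ·) with hχ
    let A : ℕ → Set X := fun n => {x | (χ x : ℝ≥0∞) ≤ f n x}
    have hA : ∀ n, MeasurableSet (A n) := fun n =>
      measurableSet_le χ.measurable.coe_nnreal_ennreal (hf n)
    have hAm : Monotone A := fun m n h x hx => le_trans hx (hm h x)
    have hU : ⋃ n, A n = univ := by
      refine eq_univ_of_forall fun x => mem_iUnion.2 ?_
      rcases eq_or_ne (ψ x) 0 with h0 | h0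
      · exact ⟨0, by simp [A, hχ, h0]⟩
      · have : (χ x : ℝ≥0∞) < ⨆ n, f n x := by
          refine lt_of_lt_of_le (ENNReal.coe_lt_coe.2 ?_) (hψ x)
          simpa [hχ] using mul_lt_of_lt_one_left (pos_iff_ne_zero.2 h0) ht
        obtain ⟨n, hn⟩ := lt_iSup_iff.1 this
        exact ⟨n, hn.le⟩
    have hL : IsLUB (range fun n => ∑ r ∈ χ.range, extSMul r (μ (χ ⁻¹' {r} ∩ A n)))
        (∑ r ∈ χ.range, extSMul r (μ (χ ⁻¹' {r}))) := by
      refine isLUB_range_finset_sum_withTop _ (fun r m n h => extSMul_mono _ (μ.mono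
        ((χ.measurableSet_fiber r).inter (hA m)) ((χ.measurableSet_fiber r).inter (hA n))
        (inter_subset_inter_right _ (hAm h))))
        (fun r n => extSMul_nonneg _ (μ.nonneg' _ ((χ.measurableSet_fiber r).inter (hA n))))
        (fun r => isLUB_range_extSMul _ ?_)
      have := μ.isLUB_range_of_monotone (fun n => (χ.measurableSet_fiber r).inter (hA n))
        (fun m n h => inter_subset_inter_right _ (hAm h))
      rwa [← inter_iUnion, hU, inter_univ] at this
    refine hL.2 ?_
    rintro _ ⟨n, rfl⟩
    dsimp only
    rw [← elemIntegral_restrict _ _ (hA n)]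
    refine hS n _ fun x => ?_
    rw [SimpleFunc.restrict_apply _ (hA n)]
    by_cases hx : x ∈ A n
    · rw [indicator_of_mem hx]
      exact hx
    · simp [hx]
  induction S using WithTop.recTopCoe with
  | top => exact le_top
  | coe s =>
    have hfin : μ.elemIntegral ψ ≠ ⊤ := by
      intro h
      have := key 2⁻¹ (by rw [← NNReal.coe_lt_coe]; norm_num)
      rw [h, extSMul_top (by norm_num)] at this
      exact WithTop.coe_ne_top (top_le_iff.1 this)
    have h0 := μ.elemIntegral_nonneg ψ
    lift μ.elemIntegral ψ to E using hfin with e he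
    have he0 : 0 ≤ e := WithTop.coe_le_coe.1 h0
    have key' : ∀ t : ℝ≥0, t < 1 → (t : ℝ) • e ≤ s := fun t ht => by
      simpa [extSMul_coe] using key t ht
    have hs0 : 0 ≤ s := by simpa using key' 0 one_pos
    -- Letting t tend to 1 without a topology: replacing t by 1 - t, the bound reads e - s ≤ t e for
    -- small t > 0, and the Archimedean property applies.
    refine WithTop.coe_le_coe.2 (sub_nonpos.1 (hE.nonpos_of_forall_le_smul he0 fun t ht => ?_))
    rcases le_or_gt 1 t with h | h
    · calc e - s ≤ e := sub_le_self _ hs0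
        _ = (1 : ℝ) • e := (one_smul _ _).symm
        _ ≤ t • e := smul_le_smul_of_nonneg_right h he0
    · have h1 := key' (1 - t).toNNReal (by rw [Real.toNNReal_lt_one]; linarith)
      rw [Real.coe_toNNReal _ (by linarith), sub_smul, one_smul] at h1
      exact sub_le_comm.1 h1

end Elementary

/-! ### The order integral of functions with values in `[0, ∞]` -/

section LIntegral

variable {X : Type*} {E : Type u} [MeasurableSpace X] [AddCommGroup E] [PartialOrder E]
  [IsOrderedAddMonoid E] [Module ℝ E] [IsOrderedModule ℝ E] (μ : OrderMeasure X E)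
  (hE : IsMonotoneComplete E)

include hE

/-- The sequence increases, so a supremum exists and the default value in `extSup` is not used. -/
theorem isLUB_elemIntegral_eapprox (f : X → ℝ≥0∞) :
    IsLUB (range fun n => μ.elemIntegral ((SimpleFunc.eapprox f n).map ENNReal.toNNReal))
      (μ.lintegral f) := by
  have h : ∃ a, IsLUB (range fun n =>
      μ.elemIntegral ((SimpleFunc.eapprox f n).map ENNReal.toNNReal)) a := by
    refine hE.exists_isLUB_withTop fun m n hmn => μ.elemIntegral_mono fun x => ?_
    exact ENNReal.toNNReal_mono (SimpleFunc.eapprox_lt_top f n x).ne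
      (SimpleFunc.monotone_eapprox f hmn x)
  rw [lintegral, extSup, dif_pos h]
  exact h.choose_spec

/-- A description of the integral that is independent of the approximating sequence; monotonicity
and monotone convergence follow from it. -/
theorem isLUB_lintegral {f : X → ℝ≥0∞} (hf : Measurable f) :
    IsLUB {a | ∃ φ : SimpleFunc X ℝ≥0, (∀ x, (φ x : ℝ≥0∞) ≤ f x) ∧ μ.elemIntegral φ = a}
      (μ.lintegral f) := by
  have hL := μ.isLUB_elemIntegral_eapprox hE f
  have hcoe : ∀ n x, (((SimpleFunc.eapprox f n).map ENNReal.toNNReal x : ℝ≥0) : ℝ≥0∞) =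
      SimpleFunc.eapprox f n x := fun n x => by
    simpa using ENNReal.coe_toNNReal (SimpleFunc.eapprox_lt_top f n x).ne
  refine ⟨?_, fun b hb => hL.2 ?_⟩
  · rintro _ ⟨φ, hφ, rfl⟩
    refine μ.elemIntegral_le_of_le_iSup hE (f := fun n => SimpleFunc.eapprox f n)
      (fun n => (SimpleFunc.eapprox f n).measurable)
      (fun m n h => SimpleFunc.monotone_eapprox f h) ?_ φ ?_
    · intro n ψ hψ
      refine (μ.elemIntegral_mono fun x => ?_).trans (hL.1 ⟨n, rfl⟩)
      rw [← ENNReal.coe_le_coe, hcoe]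
      exact hψ x
    · intro x
      rw [SimpleFunc.iSup_eapprox_apply hf]
      exact hφ x
  · rintro _ ⟨n, rfl⟩
    refine hb ⟨_, fun x => ?_, rfl⟩
    rw [hcoe]
    exact (le_iSup (fun n => SimpleFunc.eapprox f n x) n).trans
      (SimpleFunc.iSup_eapprox_apply hf x).le

theorem lintegral_coe (φ : SimpleFunc X ℝ≥0) :
    μ.lintegral (fun x => (φ x : ℝ≥0∞)) = μ.elemIntegral φ := by
  have h := μ.isLUB_lintegral hE φ.measurable.coe_nnreal_ennreal
  refine le_antisymm (h.2 ?_) (h.1 ⟨φ, fun _ => le_rfl, rfl⟩)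
  rintro _ ⟨ψ, hψ, rfl⟩
  exact μ.elemIntegral_mono fun x => ENNReal.coe_le_coe.1 (hψ x)

theorem lintegral_mono {f g : X → ℝ≥0∞} (hf : Measurable f) (hg : Measurable g)
    (h : ∀ x, f x ≤ g x) : μ.lintegral f ≤ μ.lintegral g := by
  refine (μ.isLUB_lintegral hE hf).2 ?_
  rintro _ ⟨φ, hφ, rfl⟩
  exact (μ.isLUB_lintegral hE hg).1 ⟨φ, fun x => (hφ x).trans (h x), rfl⟩

theorem lintegral_zero : μ.lintegral (fun _ => 0) = 0 := by
  have h := μ.lintegral_coe hE ((SimpleFunc.const X 0).restrict ∅)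
  rw [elemIntegral_restrict_const _ _ MeasurableSet.empty, extSMul_zero_left] at h
  simpa using h

theorem lintegral_nonneg {f : X → ℝ≥0∞} (hf : Measurable f) : 0 ≤ μ.lintegral f := by
  rw [← μ.lintegral_zero hE]
  exact μ.lintegral_mono hE measurable_const hf fun _ => zero_le

/-- The monotone convergence theorem. -/
theorem isLUB_lintegral_iSup {f : ℕ → X → ℝ≥0∞} (hf : ∀ n, Measurable (f n)) (hm : Monotone f) :
    IsLUB (range fun n => μ.lintegral (f n)) (μ.lintegral fun x => ⨆ n, f n x) := by
  have hs : Measurable fun x => ⨆ n, f n x := Measurable.iSup hf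
  refine ⟨?_, fun b hb => (μ.isLUB_lintegral hE hs).2 ?_⟩
  · rintro _ ⟨n, rfl⟩
    exact μ.lintegral_mono hE (hf n) hs fun x => le_iSup (fun n => f n x) n
  · rintro _ ⟨φ, hφ, rfl⟩
    exact μ.elemIntegral_le_of_le_iSup hE hf hm (fun n ψ hψ =>
      ((μ.isLUB_lintegral hE (hf n)).1 ⟨ψ, hψ, rfl⟩).trans (hb ⟨n, rfl⟩)) φ hφ

theorem lintegral_add {f g : X → ℝ≥0∞} (hf : Measurable f) (hg : Measurable g) :
    μ.lintegral (fun x => f x + g x) = μ.lintegral f + μ.lintegral g := by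
  let F : (X → ℝ≥0∞) → ℕ → SimpleFunc X ℝ≥0 := fun f n =>
    (SimpleFunc.eapprox f n).map ENNReal.toNNReal
  have hcoe : ∀ f n x, (F f n x : ℝ≥0∞) = SimpleFunc.eapprox f n x := fun f n x => by
    simpa [F] using ENNReal.coe_toNNReal (SimpleFunc.eapprox_lt_top f n x).ne
  have hF : ∀ f, Monotone (F f) := fun f m n hmn x =>
    ENNReal.toNNReal_mono (SimpleFunc.eapprox_lt_top f n x).ne
      (SimpleFunc.monotone_eapprox f hmn x)
  have h1 := isLUB_range_add_withTop (fun m n h => μ.elemIntegral_mono (hF f h))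
    (fun m n h => μ.elemIntegral_mono (hF g h)) (fun n => μ.elemIntegral_nonneg _)
    (fun n => μ.elemIntegral_nonneg _) (μ.isLUB_elemIntegral_eapprox hE f)
    (μ.isLUB_elemIntegral_eapprox hE g)
  have h2 := μ.isLUB_lintegral_iSup hE (f := fun n x => ((F f n + F g n : SimpleFunc X ℝ≥0) x : ℝ≥0∞))
    (fun n => (F f n + F g n).measurable.coe_nnreal_ennreal)
    (fun m n h x => ENNReal.coe_le_coe.2 (add_le_add (hF f h x) (hF g h x)))
  simp only [lintegral_coe μ hE, elemIntegral_add] at h2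
  -- The sums of the canonical approximations increase to f + g, so monotone convergence computes
  -- the supremum `h1` as the integral of f + g.
  have h3 : ∀ x, ⨆ n, (((F f n + F g n : SimpleFunc X ℝ≥0) x : ℝ≥0) : ℝ≥0∞) = f x + g x := by
    intro x
    rw [← SimpleFunc.iSup_eapprox_apply hf, ← SimpleFunc.iSup_eapprox_apply hg,
      ENNReal.iSup_add_iSup_of_monotone (fun m n h => SimpleFunc.monotone_eapprox f h x)
        (fun m n h => SimpleFunc.monotone_eapprox g h x)]
    simp only [SimpleFunc.coe_add, Pi.add_apply, ENNReal.coe_add, hcoe]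
  simp only [h3] at h2
  exact h2.unique h1

theorem lintegral_indicator_const (c : ℝ≥0) {A : Set X} (hA : MeasurableSet A) :
    μ.lintegral (A.indicator fun _ => (c : ℝ≥0∞)) = extSMul c (μ A) := by
  rw [← elemIntegral_restrict_const _ _ hA, ← μ.lintegral_coe hE]
  congr 1
  ext x
  rw [SimpleFunc.restrict_apply _ hA]
  by_cases hx : x ∈ A <;> simp [hx]

omit hE [Module ℝ E] [IsOrderedModule ℝ E] in
theorem iUnion_null {A : ℕ → Set X} (hA : ∀ n, MeasurableSet (A n)) (h0 : ∀ n, μ (A n) = 0) :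
    μ (⋃ n, A n) = 0 := by
  have hacc : ∀ n, MeasurableSet (accumulate A n) := fun n =>
    MeasurableSet.biUnion (to_countable _) fun k _ => hA k
  have h := μ.isLUB_range_of_monotone hacc monotone_accumulate
  rw [iUnion_accumulate] at h
  have h1 : ∀ n, μ (accumulate A n) = 0 := by
    intro n
    induction n with
    | zero => simpa using h0 0
    | succ n ih =>
      rw [accumulate_succ]
      exact μ.union_null (hacc n) (hA _) ih (h0 _)
  simp only [h1, range_const] at h
  exact h.unique isLUB_singleton

omit hE [Module ℝ E] [IsOrderedModule ℝ E] in
instance : CountableInterFilter μ.ae where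
  countable_sInter_mem S hS h := by
    rcases S.eq_empty_or_nonempty with rfl | hne
    · simp
    obtain ⟨s, rfl⟩ := hS.exists_eq_range hne
    have h' : ∀ n, ∃ N, MeasurableSet N ∧ μ N = 0 ∧ Nᶜ ⊆ s n := fun n => h _ ⟨n, rfl⟩
    choose N hN h0 hs using h'
    refine ⟨⋃ n, N n, MeasurableSet.iUnion hN, μ.iUnion_null hN h0, ?_⟩
    rw [compl_iUnion, sInter_range]
    exact iInter_mono hs

/-- Strict positivity of the integral. By a Chebyshev estimate each set where f ≥ 1/(n+1) is null,
and these sets cover the set where f ≠ 0. -/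
theorem ae_eq_zero_of_lintegral_eq_zero {f : X → ℝ≥0∞} (hf : Measurable f)
    (h : μ.lintegral f = 0) : ∀ᶠ x in μ.ae, f x = 0 := by
  have hA : ∀ n : ℕ, MeasurableSet {x | ((n + 1 : ℝ≥0)⁻¹ : ℝ≥0) ≤ f x} := fun n =>
    measurableSet_le measurable_const hf
  refine ⟨⋃ n : ℕ, {x | ((n + 1 : ℝ≥0)⁻¹ : ℝ≥0) ≤ f x}, MeasurableSet.iUnion hA,
    μ.iUnion_null hA fun n => le_antisymm ?_ (μ.nonneg' _ (hA n)), fun x hx => ?_⟩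
  · have h1 := μ.lintegral_mono hE (measurable_const.indicator (hA n)) hf
      (fun x => indicator_apply_le (f := fun _ => (((n + 1 : ℝ≥0)⁻¹ : ℝ≥0) : ℝ≥0∞)) fun hx => hx)
    rw [lintegral_indicator_const _ hE _ (hA n), h, extSMul_le_iff (by positivity),
      extSMul_zero_right] at h1
    exact h1
  · by_contra h0
    obtain ⟨n, hn⟩ := ENNReal.exists_inv_nat_lt h0
    refine hx (mem_iUnion.2 ⟨n, le_trans ?_ hn.le⟩)
    rw [ENNReal.coe_inv (by positivity)]
    gcongr
    push_cast
    exact le_self_add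

/-- Every multiple c·μ(f = ∞) is bounded by the finite integral of f, so the Archimedean property
forces μ(f = ∞) = 0. -/
theorem ae_ne_top_of_lintegral_ne_top {f : X → ℝ≥0∞} (hf : Measurable f)
    (h : μ.lintegral f ≠ ⊤) : ∀ᶠ x in μ.ae, f x ≠ ⊤ := by
  have hA : MeasurableSet {x | f x = ⊤} := hf (measurableSet_singleton ⊤)
  refine ⟨_, hA, ?_, fun x hx => hx⟩
  have h0 := μ.nonneg' _ hA
  have h1 : ∀ c : ℝ≥0, extSMul c (μ {x | f x = ⊤}) ≤ μ.lintegral f := by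
    intro c
    rw [← lintegral_indicator_const _ hE _ hA]
    refine μ.lintegral_mono hE (measurable_const.indicator hA) hf fun x =>
      indicator_apply_le fun hx => ?_
    rw [show f x = ⊤ from hx]
    exact le_top
  have hI := μ.lintegral_nonneg hE hf
  lift μ.lintegral f to E using h with e
  have h2 : μ {x | f x = ⊤} ≠ ⊤ := fun h => by
    have := h1 1
    rw [extSMul_one, h] at this
    exact WithTop.coe_ne_top (top_le_iff.1 this)
  lift μ {x | f x = ⊤} to E using h2 with a
  refine le_antisymm (WithTop.coe_le_coe.2
    (hE.nonpos_of_forall_le_smul (WithTop.coe_le_coe.1 hI) fun t ht => ?_)) h0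
  have := h1 (t⁻¹).toNNReal
  rw [extSMul_coe, WithTop.coe_le_coe, Real.coe_toNNReal _ (by positivity)] at this
  simpa [smul_smul, ht.ne'] using smul_le_smul_of_nonneg_left this ht.le

end LIntegral

/-! ### The order integral of real functions -/

section RealIntegral

variable {X : Type*} {E : Type u} [MeasurableSpace X] [AddCommGroup E] [PartialOrder E]
  [Module ℝ E] (μ : OrderMeasure X E)

/-- The order integral of `f : X → ℝ`, with value to be ignored outside `𝓛¹`. -/
def realIntegral (f : X → ℝ) : E :=
  (μ.lintegral fun x => ENNReal.ofReal (f x)).untopD 0 -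
    (μ.lintegral fun x => ENNReal.ofReal (-f x)).untopD 0

theorem integral_eq_realIntegral (f : μ.IntegrableFun) : μ.integral f = μ.realIntegral f.1 := rfl

theorem realIntegral_neg (f : X → ℝ) : μ.realIntegral (-f) = -μ.realIntegral f := by
  simp [realIntegral]

theorem neg_mem_integrableFun {f : X → ℝ} (hf : f ∈ μ.IntegrableFun) : -f ∈ μ.IntegrableFun :=
  ⟨hf.1.neg, by simpa using hf.2⟩

variable [IsOrderedAddMonoid E]

theorem realIntegral_congr {f g : X → ℝ} (hf : Measurable f) (hg : Measurable g)
    (h : f =ᶠ[μ.ae] g) : μ.realIntegral f = μ.realIntegral g := by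
  have e1 := μ.lintegral_congr (ENNReal.measurable_ofReal.comp hf)
    (ENNReal.measurable_ofReal.comp hg) (h.fun_comp ENNReal.ofReal)
  have e2 := μ.lintegral_congr (ENNReal.measurable_ofReal.comp hf.neg)
    (ENNReal.measurable_ofReal.comp hg.neg) (h.fun_comp fun t => ENNReal.ofReal (-t))
  exact congrArg₂ (fun a b : WithTop E => a.untopD 0 - b.untopD 0) e1 e2

variable [IsOrderedModule ℝ E] (hE : IsMonotoneComplete E)

include hE

theorem mem_integrableFun_of_abs_le {f g : X → ℝ} (hf : f ∈ μ.IntegrableFun) (hg : Measurable g)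
    (h : ∀ x, |g x| ≤ |f x|) : g ∈ μ.IntegrableFun :=
  ⟨hg, ((μ.lintegral_mono hE (measurable_norm.comp hg).ennreal_ofReal
    (measurable_norm.comp hf.1).ennreal_ofReal
    fun x => ENNReal.ofReal_le_ofReal (h x)).trans_lt hf.2.lt_top).ne⟩

theorem zero_mem_integrableFun : (0 : X → ℝ) ∈ μ.IntegrableFun := by
  refine ⟨measurable_const, ?_⟩
  simp only [Pi.zero_apply, abs_zero, ENNReal.ofReal_zero]
  rw [μ.lintegral_zero hE]
  exact WithTop.zero_ne_top

theorem abs_mem_integrableFun {f : X → ℝ} (hf : f ∈ μ.IntegrableFun) :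
    (fun x => |f x|) ∈ μ.IntegrableFun :=
  μ.mem_integrableFun_of_abs_le hE hf (measurable_norm.comp hf.1) (by simp)

theorem add_mem_integrableFun {f g : X → ℝ} (hf : f ∈ μ.IntegrableFun) (hg : g ∈ μ.IntegrableFun) :
    f + g ∈ μ.IntegrableFun := by
  have h1 : (fun x => |f x| + |g x|) ∈ μ.IntegrableFun := by
    refine ⟨(measurable_norm.comp hf.1).add (measurable_norm.comp hg.1), ?_⟩
    have : ∀ x, ENNReal.ofReal |(|f x| + |g x|)| = ENNReal.ofReal |f x| + ENNReal.ofReal |g x| :=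
      fun x => by rw [abs_of_nonneg (by positivity), ENNReal.ofReal_add (by positivity) (by positivity)]
    simp only [this]
    rw [μ.lintegral_add hE (f := fun x => ENNReal.ofReal |f x|) (g := fun x => ENNReal.ofReal |g x|)
      (measurable_norm.comp hf.1).ennreal_ofReal (measurable_norm.comp hg.1).ennreal_ofReal]
    exact WithTop.add_ne_top.2 ⟨hf.2, hg.2⟩
  exact μ.mem_integrableFun_of_abs_le hE h1 (hf.1.add hg.1)
    fun x => (abs_add_le _ _).trans (le_abs_self _)

theorem sub_mem_integrableFun {f g : X → ℝ} (hf : f ∈ μ.IntegrableFun) (hg : g ∈ μ.IntegrableFun) :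
    f - g ∈ μ.IntegrableFun :=
  sub_eq_add_neg f g ▸ μ.add_mem_integrableFun hE hf (μ.neg_mem_integrableFun hg)

theorem mul_mem_integrableFun (r : ℝ) {f : X → ℝ} (hf : f ∈ μ.IntegrableFun) :
    (fun x => r * f x) ∈ μ.IntegrableFun := by
  -- Natural multiples are integrable as repeated sums; one of them dominates r f.
  have key : ∀ n : ℕ, (n • f : X → ℝ) ∈ μ.IntegrableFun := by
    intro n
    induction n with
    | zero => simpa using μ.zero_mem_integrableFun hE
    | succ n ih =>
      rw [succ_nsmul]
      exact μ.add_mem_integrableFun hE ih hf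
  obtain ⟨n, hn⟩ := exists_nat_ge |r|
  refine μ.mem_integrableFun_of_abs_le hE (key n) (hf.1.const_mul r) fun x => ?_
  simp only [Pi.smul_apply, nsmul_eq_mul, abs_mul, Nat.abs_cast]
  gcongr

theorem sup_mem_integrableFun {f g : X → ℝ} (hf : f ∈ μ.IntegrableFun) (hg : g ∈ μ.IntegrableFun) :
    f ⊔ g ∈ μ.IntegrableFun := by
  refine μ.mem_integrableFun_of_abs_le hE (μ.add_mem_integrableFun hE
    (μ.abs_mem_integrableFun hE hf) (μ.abs_mem_integrableFun hE hg)) (hf.1.sup hg.1) fun x => ?_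
  refine abs_max_le_max_abs_abs.trans ((max_le_add_of_nonneg (abs_nonneg _) (abs_nonneg _)).trans
    (le_abs_self _))

theorem inf_mem_integrableFun {f g : X → ℝ} (hf : f ∈ μ.IntegrableFun) (hg : g ∈ μ.IntegrableFun) :
    f ⊓ g ∈ μ.IntegrableFun := by
  have := μ.neg_mem_integrableFun (μ.sup_mem_integrableFun hE (μ.neg_mem_integrableFun hf)
    (μ.neg_mem_integrableFun hg))
  rwa [neg_sup, neg_neg, neg_neg] at this

theorem lintegral_ofReal_ne_top {f : X → ℝ} (hf : f ∈ μ.IntegrableFun) :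
    μ.lintegral (fun x => ENNReal.ofReal (f x)) ≠ ⊤ :=
  ((μ.lintegral_mono hE hf.1.ennreal_ofReal (measurable_norm.comp hf.1).ennreal_ofReal
    fun _ => ENNReal.ofReal_le_ofReal (le_abs_self _)).trans_lt hf.2.lt_top).ne

theorem coe_realIntegral_of_nonneg {f : X → ℝ} (hf : f ∈ μ.IntegrableFun)
    (h : ∀ᶠ x in μ.ae, 0 ≤ f x) :
    (μ.realIntegral f : WithTop E) = μ.lintegral fun x => ENNReal.ofReal (f x) := by
  have h0 : μ.lintegral (fun x => ENNReal.ofReal (-f x)) = 0 := by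
    rw [← μ.lintegral_zero hE]
    refine μ.lintegral_congr hf.1.neg.ennreal_ofReal measurable_const ?_
    filter_upwards [h] with x hx
    simpa using hx
  have h1 := μ.lintegral_ofReal_ne_top hE hf
  rw [realIntegral, h0]
  lift μ.lintegral (fun x => ENNReal.ofReal (f x)) to E using h1 with e
  exact congrArg _ (sub_zero e)

theorem realIntegral_nonneg {f : X → ℝ} (hf : f ∈ μ.IntegrableFun) (h : ∀ᶠ x in μ.ae, 0 ≤ f x) :
    0 ≤ μ.realIntegral f := by
  rw [← WithTop.coe_le_coe, μ.coe_realIntegral_of_nonneg hE hf h]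
  exact μ.lintegral_nonneg hE hf.1.ennreal_ofReal

/-- Integrate f⁺ + q = f⁻ + p, where all terms are nonnegative, and rearrange the finite integrals
in `E`. Additivity follows by a suitable choice of p and q. -/
theorem realIntegral_eq_sub {f p q : X → ℝ} (hf : f ∈ μ.IntegrableFun) (hp : p ∈ μ.IntegrableFun)
    (hq : q ∈ μ.IntegrableFun) (hp0 : ∀ x, 0 ≤ p x) (hq0 : ∀ x, 0 ≤ q x)
    (h : ∀ x, f x = p x - q x) : μ.realIntegral f = μ.realIntegral p - μ.realIntegral q := by
  have h1 : (fun x => ENNReal.ofReal (f x) + ENNReal.ofReal (q x)) =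
      fun x => ENNReal.ofReal (-f x) + ENNReal.ofReal (p x) := by
    ext x
    rcases le_total 0 (f x) with h0 | h0
    · rw [ENNReal.ofReal_of_nonpos (neg_nonpos.2 h0), zero_add, ← ENNReal.ofReal_add h0 (hq0 x), h x,
        sub_add_cancel]
    · rw [ENNReal.ofReal_of_nonpos h0, zero_add, ← ENNReal.ofReal_add (neg_nonneg.2 h0) (hp0 x), h x]
      congr 1
      ring
  have h2 := congrArg μ.lintegral h1
  rw [μ.lintegral_add hE hf.1.ennreal_ofReal hq.1.ennreal_ofReal,
    μ.lintegral_add hE (f := fun x => ENNReal.ofReal (-f x)) hf.1.neg.ennreal_ofReal hp.1.ennreal_ofReal,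
    ← μ.coe_realIntegral_of_nonneg hE hp (Eventually.of_forall hp0),
    ← μ.coe_realIntegral_of_nonneg hE hq (Eventually.of_forall hq0)] at h2
  have h3 := μ.lintegral_ofReal_ne_top hE hf
  have h4 := μ.lintegral_ofReal_ne_top hE (μ.neg_mem_integrableFun hf)
  simp only [Pi.neg_apply] at h4
  rw [realIntegral]
  lift μ.lintegral (fun x => ENNReal.ofReal (f x)) to E using h3 with a
  lift μ.lintegral (fun x => ENNReal.ofReal (-f x)) to E using h4 with b
  have h5 : a + μ.realIntegral q = b + μ.realIntegral p := WithTop.coe_injective h2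
  rw [WithTop.untopD_coe, WithTop.untopD_coe, sub_eq_sub_iff_add_eq_add, h5, add_comm]

theorem realIntegral_add {f g : X → ℝ} (hf : f ∈ μ.IntegrableFun) (hg : g ∈ μ.IntegrableFun) :
    μ.realIntegral (f + g) = μ.realIntegral f + μ.realIntegral g := by
  have key : ∀ {p q : X → ℝ}, p ∈ μ.IntegrableFun → q ∈ μ.IntegrableFun → (∀ x, 0 ≤ p x) →
      (∀ x, 0 ≤ q x) → μ.realIntegral (p + q) = μ.realIntegral p + μ.realIntegral q := by
    intro p q hp hq hp0 hq0
    rw [μ.realIntegral_eq_sub hE hp (μ.add_mem_integrableFun hE hp hq) hq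
      (fun x => add_nonneg (hp0 x) (hq0 x)) hq0 (fun x => by simp), sub_add_cancel]
  have hz := μ.zero_mem_integrableFun hE
  have hpos : ∀ {f : X → ℝ}, f ∈ μ.IntegrableFun → f ⊔ 0 ∈ μ.IntegrableFun := fun hf =>
    μ.sup_mem_integrableFun hE hf hz
  have h0 : ∀ (f : X → ℝ) x, 0 ≤ (f ⊔ 0) x := fun f x => le_sup_right
  have hd : ∀ (f : X → ℝ) x, f x = (f ⊔ 0) x - (-f ⊔ 0) x := fun f x => by
    simp [max_zero_sub_max_neg_zero_eq_self]
  have hf' := hpos (μ.neg_mem_integrableFun hf)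
  have hg' := hpos (μ.neg_mem_integrableFun hg)
  rw [μ.realIntegral_eq_sub hE (μ.add_mem_integrableFun hE hf hg)
      (μ.add_mem_integrableFun hE (hpos hf) (hpos hg)) (μ.add_mem_integrableFun hE hf' hg')
      (fun x => add_nonneg (h0 f x) (h0 g x)) (fun x => add_nonneg (h0 _ x) (h0 _ x))
      (fun x => by rw [Pi.add_apply, hd f x, hd g x]; simp only [Pi.add_apply]; ring),
    key (hpos hf) (hpos hg) (h0 f) (h0 g), key hf' hg' (h0 _) (h0 _),
    μ.realIntegral_eq_sub hE hf (hpos hf) hf' (h0 _) (h0 _) (hd f),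
    μ.realIntegral_eq_sub hE hg (hpos hg) hg' (h0 _) (h0 _) (hd g)]
  abel

theorem realIntegral_sub {f g : X → ℝ} (hf : f ∈ μ.IntegrableFun) (hg : g ∈ μ.IntegrableFun) :
    μ.realIntegral (f - g) = μ.realIntegral f - μ.realIntegral g := by
  rw [sub_eq_add_neg, μ.realIntegral_add hE hf (μ.neg_mem_integrableFun hg), realIntegral_neg,
    sub_eq_add_neg]

theorem realIntegral_mono {f g : X → ℝ} (hf : f ∈ μ.IntegrableFun) (hg : g ∈ μ.IntegrableFun)
    (h : f ≤ᶠ[μ.ae] g) : μ.realIntegral f ≤ μ.realIntegral g := by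
  rw [← sub_nonneg, ← μ.realIntegral_sub hE hg hf]
  refine μ.realIntegral_nonneg hE (μ.sub_mem_integrableFun hE hg hf) ?_
  filter_upwards [h] with x hx
  exact sub_nonneg.2 hx

/-- Strict positivity applied to g - f. -/
theorem ae_eq_of_le_of_realIntegral_eq {f g : X → ℝ} (hf : f ∈ μ.IntegrableFun)
    (hg : g ∈ μ.IntegrableFun) (h : f ≤ᶠ[μ.ae] g) (hI : μ.realIntegral f = μ.realIntegral g) :
    f =ᶠ[μ.ae] g := by
  have hd := μ.sub_mem_integrableFun hE hg hf
  have h0 : ∀ᶠ x in μ.ae, 0 ≤ (g - f) x := h.mono fun x hx => sub_nonneg.2 hx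
  have h1 := μ.coe_realIntegral_of_nonneg hE hd h0
  rw [μ.realIntegral_sub hE hg hf, hI, sub_self] at h1
  filter_upwards [μ.ae_eq_zero_of_lintegral_eq_zero hE hd.1.ennreal_ofReal h1.symm, h] with x hx hx'
  exact le_antisymm hx' (sub_nonpos.1 (ENNReal.ofReal_eq_zero.1 hx))

theorem indicator_mem_integrableFun {A : Set X} (hA : MeasurableSet A) (h : μ A ≠ ⊤) :
    A.indicator (fun _ => (1 : ℝ)) ∈ μ.IntegrableFun := by
  refine ⟨measurable_const.indicator hA, ?_⟩
  have : (fun x => ENNReal.ofReal |A.indicator (fun _ => (1 : ℝ)) x|) =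
      A.indicator fun _ => ((1 : ℝ≥0) : ℝ≥0∞) := by
    ext x
    by_cases hx : x ∈ A <;> simp [hx]
  rwa [this, μ.lintegral_indicator_const hE _ hA, extSMul_one]

theorem coe_realIntegral_indicator {A : Set X} (hA : MeasurableSet A) (h : μ A ≠ ⊤) :
    (μ.realIntegral (A.indicator fun _ => (1 : ℝ)) : WithTop E) = μ A := by
  rw [μ.coe_realIntegral_of_nonneg hE (μ.indicator_mem_integrableFun hE hA h)
    (Eventually.of_forall fun x => indicator_nonneg (fun _ _ => zero_le_one) x)]
  have : (fun x => ENNReal.ofReal (A.indicator (fun _ => (1 : ℝ)) x)) =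
      A.indicator fun _ => ((1 : ℝ≥0) : ℝ≥0∞) := by
    ext x
    by_cases hx : x ∈ A <;> simp [hx]
  rw [this, μ.lintegral_indicator_const hE _ hA, extSMul_one]

theorem measure_ne_top_of_indicator {A : Set X} (hA : MeasurableSet A) {f : X → ℝ}
    (hf : f ∈ μ.IntegrableFun) {r : ℝ} (hr : 0 < r) (h : ∀ x ∈ A, r ≤ f x) : μ A ≠ ⊤ := by
  have h1 := μ.lintegral_mono hE (f := A.indicator fun _ => ((r.toNNReal : ℝ≥0) : ℝ≥0∞))
    (measurable_const.indicator hA) hf.1.ennreal_ofReal (fun x => by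
      by_cases hx : x ∈ A
      · rw [indicator_of_mem hx]
        exact ENNReal.ofReal_le_ofReal (h x hx)
      · rw [indicator_of_notMem hx]
        exact zero_le)
  rw [μ.lintegral_indicator_const hE _ hA] at h1
  intro ht
  rw [ht, extSMul_top (by simpa using hr)] at h1
  exact μ.lintegral_ofReal_ne_top hE hf (top_le_iff.1 h1)

/-- The monotone convergence theorem in `𝓛¹`. -/
theorem exists_tendsto_of_monotone {f : ℕ → X → ℝ} (hf : ∀ n, f n ∈ μ.IntegrableFun)
    (hm : ∀ᶠ x in μ.ae, Monotone fun n => f n x)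
    (hb : BddAbove (range fun n => μ.realIntegral (f n))) :
    ∃ g ∈ μ.IntegrableFun, (∀ᶠ x in μ.ae, Tendsto (fun n => f n x) atTop (nhds (g x))) ∧
      IsLUB (range fun n => μ.realIntegral (f n)) (μ.realIntegral g) := by
  obtain ⟨b, hb⟩ := hb
  let d : ℕ → X → ℝ := fun n => f n - f 0
  have hd : ∀ n, d n ∈ μ.IntegrableFun := fun n => μ.sub_mem_integrableFun hE (hf n) (hf 0)
  have hd0 : ∀ n, ∀ᶠ x in μ.ae, 0 ≤ d n x := fun n => by
    filter_upwards [hm] with x hx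
    exact sub_nonneg.2 (hx (Nat.zero_le n))
  let D : ℕ → X → ℝ≥0∞ := fun n x => ENNReal.ofReal (d n x)
  have hD : ∀ n, Measurable (D n) := fun n => (hd n).1.ennreal_ofReal
  -- The sequence `D` is only almost everywhere increasing. Its partial suprema increase everywhere
  -- and agree with it off a null set.
  let G : ℕ → X → ℝ≥0∞ := partialSups D
  have hG : ∀ n, Measurable (G n) := fun n => by
    induction n with
    | zero => simpa [G] using hD 0
    | succ n ih => simpa [G, partialSups_add_one] using ih.sup (hD (n + 1))
  have hGm : Monotone G := (partialSups D).monotone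
  have hGD : ∀ n, ∀ᶠ x in μ.ae, G n x = D n x := fun n => by
    filter_upwards [hm] with x hx
    have hDm : Monotone fun n => D n x := fun m n h =>
      ENNReal.ofReal_le_ofReal (sub_le_sub_right (hx h) _)
    refine le_antisymm ?_ (le_partialSups D n x)
    simp only [G, Pi.partialSups_apply]
    exact partialSups_le _ _ _ fun k hk => hDm hk
  have hL := μ.isLUB_lintegral_iSup hE hG hGm
  set H : X → ℝ≥0∞ := fun x => ⨆ n, G n x with hH
  have hHm : Measurable H := Measurable.iSup hG
  have hGI : ∀ n, μ.lintegral (G n) = (μ.realIntegral (f n) - μ.realIntegral (f 0) : E) := by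
    intro n
    rw [μ.lintegral_congr (hG n) (hD n) (hGD n), ← μ.realIntegral_sub hE (hf n) (hf 0)]
    exact (μ.coe_realIntegral_of_nonneg hE (hd n) (hd0 n)).symm
  have hHt : μ.lintegral H ≠ ⊤ := by
    suffices h : μ.lintegral H ≤ (b - μ.realIntegral (f 0) : E) from
      (h.trans_lt (WithTop.coe_lt_top _)).ne
    refine hL.2 ?_
    rintro _ ⟨n, rfl⟩
    simp only [hGI]
    exact WithTop.coe_le_coe.2 (sub_le_sub_right (hb ⟨n, rfl⟩) _)
  -- Bounded integrals make the limit finite almost everywhere, so passing to real values by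
  -- `toReal` changes it on a null set only.
  have hHa := μ.ae_ne_top_of_lintegral_ne_top hE hHm hHt
  have hcongr : μ.lintegral (fun x => ENNReal.ofReal (H x).toReal) = μ.lintegral H := by
    refine μ.lintegral_congr hHm.ennreal_toReal.ennreal_ofReal hHm ?_
    filter_upwards [hHa] with x hx
    exact ENNReal.ofReal_toReal hx
  have hHi : (fun x => (H x).toReal) ∈ μ.IntegrableFun := by
    refine ⟨hHm.ennreal_toReal, ?_⟩
    simp only [ENNReal.abs_toReal]
    rwa [hcongr]
  have hHI : (μ.realIntegral (fun x => (H x).toReal) : WithTop E) = μ.lintegral H := by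
    rw [← hcongr]
    exact μ.coe_realIntegral_of_nonneg hE hHi (Eventually.of_forall fun x => ENNReal.toReal_nonneg)
  refine ⟨f 0 + fun x => (H x).toReal, μ.add_mem_integrableFun hE (hf 0) hHi, ?_, ?_⟩
  · filter_upwards [hHa, hm, eventually_countable_forall.2 hGD, eventually_countable_forall.2 hd0]
      with x hx hmx hGx hdx
    have h1 : Tendsto (fun n => G n x) atTop (nhds (H x)) :=
      tendsto_atTop_iSup fun m n h => hGm h x
    have h2 := ((ENNReal.tendsto_toReal hx).comp h1).const_add (f 0 x)
    refine h2.congr fun n => ?_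
    rw [Function.comp_apply, hGx n, ENNReal.toReal_ofReal (hdx n)]
    simp [d]
  · rw [← hHI] at hL
    simp only [hGI] at hL
    have h3 := isLUB_range_coe_withTop.1 hL
    rw [μ.realIntegral_add hE (hf 0) hHi]
    refine ⟨?_, fun c hc => ?_⟩
    · rintro _ ⟨n, rfl⟩
      exact sub_le_iff_le_add'.1 (h3.1 ⟨n, rfl⟩)
    · refine le_sub_iff_add_le'.1 (h3.2 ?_)
      rintro _ ⟨n, rfl⟩
      exact sub_le_sub_right (hc ⟨n, rfl⟩) _

theorem exists_tendsto_of_antitone {f : ℕ → X → ℝ} (hf : ∀ n, f n ∈ μ.IntegrableFun)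
    (hm : ∀ᶠ x in μ.ae, Antitone fun n => f n x)
    (hb : BddBelow (range fun n => μ.realIntegral (f n))) :
    ∃ g ∈ μ.IntegrableFun, (∀ᶠ x in μ.ae, Tendsto (fun n => f n x) atTop (nhds (g x))) ∧
      IsGLB (range fun n => μ.realIntegral (f n)) (μ.realIntegral g) := by
  obtain ⟨b, hb⟩ := hb
  obtain ⟨g, hg, ht, hI⟩ := μ.exists_tendsto_of_monotone hE (f := fun n => -f n)
    (fun n => μ.neg_mem_integrableFun (hf n)) (hm.mono fun x hx m n h => neg_le_neg (hx h))
    ⟨-b, by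
      rintro _ ⟨n, rfl⟩
      dsimp only
      rw [realIntegral_neg]
      exact neg_le_neg (hb ⟨n, rfl⟩)⟩
  refine ⟨-g, μ.neg_mem_integrableFun hg, ht.mono fun x hx => by simpa using hx.neg, ?_⟩
  rw [isGLB_range_iff_isLUB_neg, realIntegral_neg, neg_neg]
  simpa only [realIntegral_neg] using hI

/-- This turns a supremum in `E` into almost everywhere convergence: by monotone convergence the
sequence has a limit h ≤ g with the same integral as g, so h = g almost everywhere. -/
theorem tendsto_of_isLUB {f : ℕ → X → ℝ} (hf : ∀ n, f n ∈ μ.IntegrableFun)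
    (hm : ∀ᶠ x in μ.ae, Monotone fun n => f n x) {g : X → ℝ} (hg : g ∈ μ.IntegrableFun)
    (hle : ∀ n, f n ≤ᶠ[μ.ae] g)
    (hI : IsLUB (range fun n => μ.realIntegral (f n)) (μ.realIntegral g)) :
    ∀ᶠ x in μ.ae, Tendsto (fun n => f n x) atTop (nhds (g x)) := by
  obtain ⟨h, hh, ht, hIh⟩ := μ.exists_tendsto_of_monotone hE hf hm ⟨_, hI.1⟩
  have h1 : h ≤ᶠ[μ.ae] g := by
    filter_upwards [ht, eventually_countable_forall.2 hle] with x hx hx'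
    exact le_of_tendsto' hx hx'
  filter_upwards [ht, μ.ae_eq_of_le_of_realIntegral_eq hE hh hg h1 (hIh.unique hI)] with x hx hx'
  rwa [← hx']

theorem tendsto_of_isGLB {f : ℕ → X → ℝ} (hf : ∀ n, f n ∈ μ.IntegrableFun)
    (hm : ∀ᶠ x in μ.ae, Antitone fun n => f n x) {g : X → ℝ} (hg : g ∈ μ.IntegrableFun)
    (hle : ∀ n, g ≤ᶠ[μ.ae] f n)
    (hI : IsGLB (range fun n => μ.realIntegral (f n)) (μ.realIntegral g)) :
    ∀ᶠ x in μ.ae, Tendsto (fun n => f n x) atTop (nhds (g x)) := by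
  obtain ⟨h, hh, ht, hIh⟩ := μ.exists_tendsto_of_antitone hE hf hm ⟨_, hI.1⟩
  have h1 : g ≤ᶠ[μ.ae] h := by
    filter_upwards [ht, eventually_countable_forall.2 hle] with x hx hx'
    exact ge_of_tendsto' hx hx'
  filter_upwards [ht, μ.ae_eq_of_le_of_realIntegral_eq hE hg hh h1 (hI.unique hIh)] with x hx hx'
  rwa [hx']

end RealIntegral

end OrderMeasure

/-! ### Ups and downs of sets of functions -/

theorem seqUp_mono {α : Type u} [PartialOrder α] {S S' : Set α} (h : S ⊆ S') :
    seqUp S ⊆ seqUp S' := fun _ ⟨v, hv, hm, hx⟩ => ⟨v, fun n => h (hv n), hm, hx⟩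

theorem seqDown_mono {α : Type u} [PartialOrder α] {S S' : Set α} (h : S ⊆ S') :
    seqDown S ⊆ seqDown S' := fun _ ⟨v, hv, hm, hx⟩ => ⟨v, fun n => h (hv n), hm, hx⟩

theorem subset_seqDown {α : Type u} [PartialOrder α] (S : Set α) : S ⊆ seqDown S :=
  fun x hx => ⟨fun _ => x, fun _ => hx, antitone_const, by simp⟩

theorem subset_netUp {α : Type u} [PartialOrder α] (S : Set α) : S ⊆ netUp S :=
  fun x hx => ⟨PUnit, inferInstance, inferInstance, inferInstance, fun _ => x, fun _ => hx,
    monotone_const, by simp⟩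

theorem subset_netDown {α : Type u} [PartialOrder α] (S : Set α) : S ⊆ netDown S :=
  fun x hx => ⟨PUnit, inferInstance, inferInstance, inferInstance, fun _ => x, fun _ => hx,
    antitone_const, by simp⟩

theorem indicator_one_mono {X : Type*} {A B : Set X} (h : A ⊆ B) (x : X) :
    A.indicator (fun _ => (1 : ℝ)) x ≤ B.indicator (fun _ => (1 : ℝ)) x :=
  indicator_le_indicator_of_subset h (fun _ => zero_le_one) x

/-- `S` is closed under the pointwise application of the binary operation `F`. -/
def ClosedUnder {X : Type*} (F : ℝ → ℝ → ℝ) (S : Set (X → ℝ)) : Prop :=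
  ∀ f ∈ S, ∀ g ∈ S, (fun x => F (f x) (g x)) ∈ S

theorem partialSups_mem_of_closedUnder_max {X : Type*} {S : Set (X → ℝ)}
    (hS : ClosedUnder max S) {f : ℕ → X → ℝ} (hf : ∀ n, f n ∈ S) (n : ℕ) :
    partialSups f n ∈ S := by
  induction n with
  | zero => simpa using hf 0
  | succ n ih =>
    rw [partialSups_add_one]
    exact hS _ ih _ (hf _)

namespace OrderMeasure

section UpsDowns

variable {X : Type*} {E : Type u} [MeasurableSpace X] [AddCommGroup E] [PartialOrder E]
  [Module ℝ E] [IsOrderedAddMonoid E] (μ : OrderMeasure X E)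

/-- The integrable functions that are almost everywhere the limit of an almost everywhere increasing
sequence in `S`. -/
def aeUp (S : Set (X → ℝ)) : Set (X → ℝ) :=
  {f | f ∈ μ.IntegrableFun ∧ ∃ v : ℕ → X → ℝ, (∀ n, v n ∈ S) ∧
    (∀ᶠ x in μ.ae, Monotone fun n => v n x) ∧
    ∀ᶠ x in μ.ae, Tendsto (fun n => v n x) atTop (nhds (f x))}

/-- The integrable functions that are almost everywhere the limit of an almost everywhere decreasing
sequence in `S`. -/
def aeDown (S : Set (X → ℝ)) : Set (X → ℝ) :=
  {f | f ∈ μ.IntegrableFun ∧ ∃ v : ℕ → X → ℝ, (∀ n, v n ∈ S) ∧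
    (∀ᶠ x in μ.ae, Antitone fun n => v n x) ∧
    ∀ᶠ x in μ.ae, Tendsto (fun n => v n x) atTop (nhds (f x))}

theorem aeUp_mono {S S' : Set (X → ℝ)} (h : S ⊆ S') : μ.aeUp S ⊆ μ.aeUp S' :=
  fun _ ⟨hi, v, hv, h'⟩ => ⟨hi, v, fun n => h (hv n), h'⟩

theorem aeDown_mono {S S' : Set (X → ℝ)} (h : S ⊆ S') : μ.aeDown S ⊆ μ.aeDown S' :=
  fun _ ⟨hi, v, hv, h'⟩ => ⟨hi, v, fun n => h (hv n), h'⟩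

theorem aeUp_subset (S : Set (X → ℝ)) : μ.aeUp S ⊆ μ.IntegrableFun := fun _ h => h.1

theorem aeDown_subset (S : Set (X → ℝ)) : μ.aeDown S ⊆ μ.IntegrableFun := fun _ h => h.1

theorem subset_aeDown {S : Set (X → ℝ)} (hS : S ⊆ μ.IntegrableFun) : S ⊆ μ.aeDown S := fun f hf =>
  ⟨hS hf, fun _ => f, fun _ => hf, Eventually.of_forall fun _ => antitone_const,
    Eventually.of_forall fun _ => tendsto_const_nhds⟩

variable {F : ℝ → ℝ → ℝ} {S : Set (X → ℝ)}

theorem closedUnder_aeUp (hF : Continuous fun p : ℝ × ℝ => F p.1 p.2)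
    (hm : ∀ a a' b b', a ≤ a' → b ≤ b' → F a b ≤ F a' b')
    (hi : ClosedUnder F μ.IntegrableFun) (hS : ClosedUnder F S) : ClosedUnder F (μ.aeUp S) := by
  rintro f ⟨hf, v, hv, hvm, hvt⟩ g ⟨hg, w, hw, hwm, hwt⟩
  refine ⟨hi f hf g hg, fun n x => F (v n x) (w n x), fun n => hS _ (hv n) _ (hw n), ?_, ?_⟩
  · filter_upwards [hvm, hwm] with x h1 h2 m n h
    exact hm _ _ _ _ (h1 h) (h2 h)
  · filter_upwards [hvt, hwt] with x h1 h2
    exact (hF.tendsto (f x, g x)).comp (h1.prodMk_nhds h2)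

theorem closedUnder_aeDown (hF : Continuous fun p : ℝ × ℝ => F p.1 p.2)
    (hm : ∀ a a' b b', a ≤ a' → b ≤ b' → F a b ≤ F a' b')
    (hi : ClosedUnder F μ.IntegrableFun) (hS : ClosedUnder F S) : ClosedUnder F (μ.aeDown S) := by
  rintro f ⟨hf, v, hv, hvm, hvt⟩ g ⟨hg, w, hw, hwm, hwt⟩
  refine ⟨hi f hf g hg, fun n x => F (v n x) (w n x), fun n => hS _ (hv n) _ (hw n), ?_, ?_⟩
  · filter_upwards [hvm, hwm] with x h1 h2 m n h
    exact hm _ _ _ _ (h1 h) (h2 h)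
  · filter_upwards [hvt, hwt] with x h1 h2
    exact (hF.tendsto (f x, g x)).comp (h1.prodMk_nhds h2)

/-- A diagonal argument: if w k n increases in n to v k, and v k increases to f, then the maximum of
w 0 n, …, w n n increases to f. -/
theorem aeUp_aeUp_subset (hS : ClosedUnder max S) : μ.aeUp (μ.aeUp S) ⊆ μ.aeUp S := by
  rintro f ⟨hf, v, hv, hvm, hvt⟩
  choose _ w hw hwm hwt using hv
  refine ⟨hf, fun n => partialSups (fun k => w k n) n,
    fun n => partialSups_mem_of_closedUnder_max hS (fun k => hw k n) n, ?_, ?_⟩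
  · filter_upwards [eventually_countable_forall.2 hwm] with x h
    refine monotone_nat_of_le_succ fun n => ?_
    simp only [Pi.partialSups_apply]
    refine partialSups_le _ _ _ fun k hk => ?_
    exact (h k n.le_succ).trans (le_partialSups_of_le (fun k => w k (n + 1) x) (hk.trans n.le_succ))
  · filter_upwards [eventually_countable_forall.2 hwm, eventually_countable_forall.2 hwt, hvm, hvt]
      with x h1 h2 h3 h4
    simp only [Pi.partialSups_apply]
    refine tendsto_order.2 ⟨fun a ha => ?_, fun a ha => Eventually.of_forall fun n => ?_⟩
    · obtain ⟨k, hk⟩ := ((tendsto_order.1 h4).1 a ha).exists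
      filter_upwards [(tendsto_order.1 (h2 k)).1 a hk, eventually_ge_atTop k] with n hn hkn
      exact hn.trans_le (le_partialSups_of_le (fun k => w k n x) hkn)
    · refine lt_of_le_of_lt (partialSups_le _ _ _ fun k _ => ?_) ha
      exact ((h1 k).ge_of_tendsto (h2 k) n).trans (h3.ge_of_tendsto h4 k)

theorem neg_mem_aeUp_of_mem_aeDown {f : X → ℝ} (hf : f ∈ μ.aeDown S) :
    -f ∈ μ.aeUp {g | -g ∈ S} := by
  obtain ⟨hf, v, hv, hvm, hvt⟩ := hf
  exact ⟨μ.neg_mem_integrableFun hf, fun n => -v n, fun n => by simpa using hv n,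
    hvm.mono fun x hx => hx.neg, hvt.mono fun x hx => hx.neg⟩

theorem neg_mem_aeDown_of_mem_aeUp {f : X → ℝ} (hf : f ∈ μ.aeUp {g | -g ∈ S}) :
    -f ∈ μ.aeDown S := by
  obtain ⟨hf, v, hv, hvm, hvt⟩ := hf
  exact ⟨μ.neg_mem_integrableFun hf, fun n => -v n, hv,
    hvm.mono fun x hx => hx.neg, hvt.mono fun x hx => hx.neg⟩

theorem aeDown_aeDown_subset (hS : ClosedUnder min S) : μ.aeDown (μ.aeDown S) ⊆ μ.aeDown S := by
  intro f hf
  have h1 := μ.aeUp_mono (S' := μ.aeUp {g | -g ∈ S})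
    (fun g hg => by simpa using μ.neg_mem_aeUp_of_mem_aeDown hg) (μ.neg_mem_aeUp_of_mem_aeDown hf)
  have h2 : ClosedUnder max {g : X → ℝ | -g ∈ S} := fun g hg h hh => by
    have := hS _ hg _ hh
    simp only [Pi.neg_apply, min_neg_neg] at this
    exact this
  simpa using μ.neg_mem_aeDown_of_mem_aeUp (μ.aeUp_aeUp_subset h2 h1)

/-- The classes in `L¹` of the members of `S`. -/
def classes (S : Set (X → ℝ)) : Set μ.L1 := {a | ∃ f ∈ S, (f : Germ μ.ae ℝ) = a.1}

/-- An almost everywhere limit of an increasing sequence is its supremum in L¹: an upper bound in L¹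
dominates the whole sequence off one null set, because there are only countably many terms. -/
theorem classes_aeUp_subset (hS : S ⊆ μ.IntegrableFun) :
    μ.classes (μ.aeUp S) ⊆ seqUp (μ.classes S) := by
  rintro ⟨_, f, hf, rfl⟩ ⟨g, ⟨hg, v, hv, hvm, hvt⟩, hgf⟩
  have hgf : g =ᶠ[μ.ae] f := Germ.coe_eq.1 hgf
  refine ⟨fun n => ⟨v n, v n, hS (hv n), rfl⟩, fun n => ⟨v n, hv n, rfl⟩, fun m n h => ?_, ?_, ?_⟩
  · exact Germ.coe_le.2 (hvm.mono fun x hx => hx h)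
  · rintro _ ⟨n, rfl⟩
    refine Germ.coe_le.2 ?_
    filter_upwards [hvm, hvt, hgf] with x h1 h2 h3
    exact (h1.ge_of_tendsto h2 n).trans h3.le
  · rintro ⟨_, k, hk, rfl⟩ hb
    refine Germ.coe_le.2 ?_
    have h4 : ∀ n, ∀ᶠ x in μ.ae, v n x ≤ k x := fun n => Germ.coe_le.1 (hb ⟨n, rfl⟩)
    filter_upwards [eventually_countable_forall.2 h4, hvt, hgf] with x h1 h2 h3
    exact h3.ge.trans (le_of_tendsto' h2 h1)

theorem classes_aeDown_subset (hS : S ⊆ μ.IntegrableFun) :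
    μ.classes (μ.aeDown S) ⊆ seqDown (μ.classes S) := by
  rintro ⟨_, f, hf, rfl⟩ ⟨g, ⟨hg, v, hv, hvm, hvt⟩, hgf⟩
  have hgf : g =ᶠ[μ.ae] f := Germ.coe_eq.1 hgf
  refine ⟨fun n => ⟨v n, v n, hS (hv n), rfl⟩, fun n => ⟨v n, hv n, rfl⟩, fun m n h => ?_, ?_, ?_⟩
  · exact Germ.coe_le.2 (hvm.mono fun x hx => hx h)
  · rintro _ ⟨n, rfl⟩
    refine Germ.coe_le.2 ?_
    filter_upwards [hvm, hvt, hgf] with x h1 h2 h3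
    exact h3.ge.trans (h1.le_of_tendsto h2 n)
  · rintro ⟨_, k, hk, rfl⟩ hb
    refine Germ.coe_le.2 ?_
    have h4 : ∀ n, ∀ᶠ x in μ.ae, k x ≤ v n x := fun n => Germ.coe_le.1 (hb ⟨n, rfl⟩)
    filter_upwards [eventually_countable_forall.2 h4, hvt, hgf] with x h1 h2 h3
    exact (ge_of_tendsto' h2 h1).trans h3.le

theorem integralL1_eq (a : μ.L1) {f : X → ℝ} (hf : f ∈ μ.IntegrableFun)
    (h : (f : Germ μ.ae ℝ) = a.1) : μ.integralL1 a = μ.realIntegral f := by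
  rw [← μ.integral_eq_realIntegral ⟨f, hf⟩, ← integralL1_toL1]
  exact congrArg _ (Subtype.ext h.symm)

variable [IsOrderedModule ℝ E] (hE : IsMonotoneComplete E)

include hE

/-- The supremum in L¹ has to be identified with the pointwise limit k. Monotone convergence
provides k in 𝓛¹; its class is an upper bound of the sequence and lies below every other, so it
equals `a`, and its integral is the supremum. -/
theorem isLUB_integralL1 {v : ℕ → μ.L1} (hv : Monotone v) {a : μ.L1} (ha : IsLUB (range v) a) :
    IsLUB (range fun n => μ.integralL1 (v n)) (μ.integralL1 a) := by
  have hr : ∀ n, ∃ f ∈ μ.IntegrableFun, (f : Germ μ.ae ℝ) = (v n).1 := fun n => (v n).2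
  choose f hf hfv using hr
  have hm : ∀ᶠ x in μ.ae, Monotone fun n => f n x := by
    have : ∀ n, ∀ᶠ x in μ.ae, f n x ≤ f (n + 1) x := fun n => by
      refine Germ.coe_le.1 ?_
      rw [hfv, hfv]
      exact hv n.le_succ
    exact (eventually_countable_forall.2 this).mono fun x hx => monotone_nat_of_le_succ hx
  obtain ⟨g, hg, hga⟩ := a.2
  have hfg : ∀ n, f n ≤ᶠ[μ.ae] g := fun n => by
    refine Germ.coe_le.1 ?_
    rw [hfv, hga]
    exact ha.1 ⟨n, rfl⟩
  obtain ⟨k, hk, hkt, hkI⟩ := μ.exists_tendsto_of_monotone hE hf hm ⟨μ.realIntegral g, by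
    rintro _ ⟨n, rfl⟩
    exact μ.realIntegral_mono hE (hf n) hg (hfg n)⟩
  have hka : (k : Germ μ.ae ℝ) = a.1 := by
    rw [← hga]
    refine le_antisymm ?_ ?_
    · refine Germ.coe_le.2 ?_
      filter_upwards [hkt, eventually_countable_forall.2 hfg] with x h1 h2
      exact le_of_tendsto' h1 h2
    · rw [hga]
      suffices h : (⟨k, k, hk, rfl⟩ : μ.L1) ∈ upperBounds (range v) from ha.2 h
      rintro _ ⟨n, rfl⟩
      change (v n).1 ≤ (k : Germ μ.ae ℝ)
      rw [← hfv n]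
      refine Germ.coe_le.2 ?_
      filter_upwards [hkt, hm] with x h1 h2
      exact h2.ge_of_tendsto h1 n
  rw [μ.integralL1_eq a hk hka]
  simpa only [μ.integralL1_eq (v _) (hf _) (hfv _)] using hkI

theorem isGLB_integralL1 {v : ℕ → μ.L1} (hv : Antitone v) {a : μ.L1} (ha : IsGLB (range v) a) :
    IsGLB (range fun n => μ.integralL1 (v n)) (μ.integralL1 a) := by
  have hr : ∀ n, ∃ f ∈ μ.IntegrableFun, (f : Germ μ.ae ℝ) = (v n).1 := fun n => (v n).2
  choose f hf hfv using hr
  have hm : ∀ᶠ x in μ.ae, Antitone fun n => f n x := by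
    have : ∀ n, ∀ᶠ x in μ.ae, f (n + 1) x ≤ f n x := fun n => by
      refine Germ.coe_le.1 ?_
      rw [hfv, hfv]
      exact hv n.le_succ
    exact (eventually_countable_forall.2 this).mono fun x hx => antitone_nat_of_succ_le hx
  obtain ⟨g, hg, hga⟩ := a.2
  have hfg : ∀ n, g ≤ᶠ[μ.ae] f n := fun n => by
    refine Germ.coe_le.1 ?_
    rw [hfv, hga]
    exact ha.1 ⟨n, rfl⟩
  obtain ⟨k, hk, hkt, hkI⟩ := μ.exists_tendsto_of_antitone hE hf hm ⟨μ.realIntegral g, by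
    rintro _ ⟨n, rfl⟩
    exact μ.realIntegral_mono hE hg (hf n) (hfg n)⟩
  have hka : (k : Germ μ.ae ℝ) = a.1 := by
    rw [← hga]
    refine le_antisymm ?_ ?_
    · rw [hga]
      suffices h : (⟨k, k, hk, rfl⟩ : μ.L1) ∈ lowerBounds (range v) from ha.2 h
      rintro _ ⟨n, rfl⟩
      change (k : Germ μ.ae ℝ) ≤ (v n).1
      rw [← hfv n]
      refine Germ.coe_le.2 ?_
      filter_upwards [hkt, hm] with x h1 h2
      exact h2.le_of_tendsto h1 n
    · refine Germ.coe_le.2 ?_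
      filter_upwards [hkt, eventually_countable_forall.2 hfg] with x h1 h2
      exact ge_of_tendsto' h1 h2
  rw [μ.integralL1_eq a hk hka]
  simpa only [μ.integralL1_eq (v _) (hf _) (hfv _)] using hkI

theorem integralL1_mono {a b : μ.L1} (h : a ≤ b) : μ.integralL1 a ≤ μ.integralL1 b := by
  obtain ⟨f, hf, hfa⟩ := a.2
  obtain ⟨g, hg, hgb⟩ := b.2
  rw [μ.integralL1_eq a hf hfa, μ.integralL1_eq b hg hgb]
  refine μ.realIntegral_mono hE hf hg (Germ.coe_le.1 ?_)
  rw [hfa, hgb]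
  exact h

theorem image_integralL1_seqUp_subset (B : Set μ.L1) :
    μ.integralL1 '' seqUp B ⊆ seqUp (μ.integralL1 '' B) := by
  rintro _ ⟨a, ⟨v, hv, hm, ha⟩, rfl⟩
  exact ⟨_, fun n => ⟨v n, hv n, rfl⟩, fun m n h => μ.integralL1_mono hE (hm h),
    μ.isLUB_integralL1 hE hm ha⟩

theorem image_integralL1_seqDown_subset (B : Set μ.L1) :
    μ.integralL1 '' seqDown B ⊆ seqDown (μ.integralL1 '' B) := by
  rintro _ ⟨a, ⟨v, hv, hm, ha⟩, rfl⟩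
  exact ⟨_, fun n => ⟨v n, hv n, rfl⟩, fun m n h => μ.integralL1_mono hE (hm h),
    μ.isGLB_integralL1 hE hm ha⟩

end UpsDowns

end OrderMeasure

/-! ### Sequences from the countable sup property -/

section CountableSup

variable {E : Type u} [AddCommGroup E] [PartialOrder E]

theorem exists_monotone_nat_ge {α : Type*} [Preorder α] (hd : ∀ a b : α, ∃ c, a ≤ c ∧ b ≤ c)
    (k : ℕ → α) : ∃ i : ℕ → α, Monotone i ∧ ∀ n, k n ≤ i n := by
  choose d h1 h2 using hd
  let i : ℕ → α := fun n => Nat.rec (k 0) (fun n r => d r (k (n + 1))) n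
  refine ⟨i, monotone_nat_of_le_succ fun n => h1 _ _, fun n => ?_⟩
  cases n with
  | zero => exact le_rfl
  | succ n => exact h2 _ _

theorem HasCountableSupProperty.exists_monotone_isLUB (h : HasCountableSupProperty E)
    {α : Type*} [Preorder α] [Nonempty α] (hd : ∀ a b : α, ∃ c, a ≤ c ∧ b ≤ c) {m : α → E}
    (hm : Monotone m) (h0 : ∀ a, 0 ≤ m a) {x : E} (hx : IsLUB (range m) x) :
    ∃ i : ℕ → α, Monotone i ∧ IsLUB (range fun n => m (i n)) x := by
  -- The index type may live in another universe than `E`. The range of `m` does not, and it is a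
  -- directed set with the same supremum.
  have : IsDirected (range m) (· ≤ ·) := ⟨by
    rintro ⟨_, a, rfl⟩ ⟨_, b, rfl⟩
    obtain ⟨c, hac, hbc⟩ := hd a b
    exact ⟨⟨_, c, rfl⟩, hm hac, hm hbc⟩⟩
  obtain ⟨k, hk⟩ := h (range m) Subtype.val x (by rintro ⟨_, a, rfl⟩; exact h0 a)
    (fun _ _ h => h) (by rwa [Subtype.range_coe])
  have : ∀ n, ∃ a, m a = k n := fun n => (k n).2
  choose j hj using this
  obtain ⟨i, hi, hji⟩ := exists_monotone_nat_ge hd j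
  refine ⟨i, hi, ?_, fun b hb => hk.2 ?_⟩
  · rintro _ ⟨n, rfl⟩
    exact hx.1 ⟨_, rfl⟩
  · rintro _ ⟨n, rfl⟩
    dsimp only
    rw [← hj n]
    exact (hm (hji n)).trans (hb ⟨n, rfl⟩)

/-- The countable sup property concerns nonnegative increasing nets, so it is applied to m a₀ - m a
for a ≤ a₀ with the order reversed. By directedness, restricting to a ≤ a₀ does not alter the
infimum. -/
theorem HasCountableSupProperty.exists_antitone_isGLB [IsOrderedAddMonoid E]
    (h : HasCountableSupProperty E)
    {α : Type*} [Preorder α] [Nonempty α] (hd : ∀ a b : α, ∃ c, c ≤ a ∧ c ≤ b) {m : α → E}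
    (hm : Monotone m) {x : E} (hx : IsGLB (range m) x) :
    ∃ i : ℕ → α, Antitone i ∧ IsGLB (range fun n => m (i n)) x := by
  obtain ⟨a₀⟩ := ‹Nonempty α›
  let β := {a : αᵒᵈ // OrderDual.ofDual a ≤ a₀}
  have : Nonempty β := ⟨⟨OrderDual.toDual a₀, le_rfl⟩⟩
  obtain ⟨i, hi, hL⟩ := h.exists_monotone_isLUB (α := β)
    (m := fun a => m a₀ - m (OrderDual.ofDual a.1)) (x := m a₀ - x)
    (by
      rintro ⟨a, ha⟩ ⟨b, hb⟩
      obtain ⟨c, hca, hcb⟩ := hd (OrderDual.ofDual a) (OrderDual.ofDual b)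
      exact ⟨⟨OrderDual.toDual c, hca.trans ha⟩, hca, hcb⟩)
    (fun a b hab => sub_le_sub_left (hm hab) _)
    (fun a => sub_nonneg.2 (hm a.2))
    (by
      refine ⟨?_, fun b hb => ?_⟩
      · rintro _ ⟨a, rfl⟩
        exact sub_le_sub_left (hx.1 ⟨_, rfl⟩) _
      · refine sub_le_comm.1 (hx.2 ?_)
        rintro _ ⟨a, rfl⟩
        obtain ⟨c, hca, hc⟩ := hd a a₀
        exact (sub_le_comm.1 (hb ⟨⟨OrderDual.toDual c, hc⟩, rfl⟩)).trans (hm hca))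
  refine ⟨fun n => OrderDual.ofDual (i n).1, fun m n h => hi h, ?_, fun b hb => ?_⟩
  · rintro _ ⟨n, rfl⟩
    exact hx.1 ⟨_, rfl⟩
  · refine (sub_le_sub_iff_left (m a₀)).1 (hL.2 ?_)
    rintro _ ⟨n, rfl⟩
    exact sub_le_sub_left (hb ⟨n, rfl⟩) _

end CountableSup

namespace OrderMeasure

/-! ### The image of the positive cone -/

section PosCone

variable {X : Type*} {E : Type u} [MeasurableSpace X] [AddCommGroup E] [PartialOrder E]
  [IsOrderedAddMonoid E] [Module ℝ E] [IsOrderedModule ℝ E] (μ : OrderMeasure X E)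

omit [IsOrderedAddMonoid E] [IsOrderedModule ℝ E] in
theorem mem_integralPosCone {x : E} : x ∈ μ.integralPosCone ↔
    ∃ f ∈ μ.IntegrableFun, (∀ x, 0 ≤ f x) ∧ μ.realIntegral f = x := by
  constructor
  · rintro ⟨f, hf, rfl⟩
    exact ⟨f.1, f.2, hf, rfl⟩
  · rintro ⟨f, hf, h0, rfl⟩
    exact ⟨⟨f, hf⟩, h0, rfl⟩

variable (hE : IsMonotoneComplete E)

include hE

theorem realIntegral_mem_integralPosCone {f : X → ℝ} (hf : f ∈ μ.IntegrableFun)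
    (h0 : ∀ᶠ x in μ.ae, 0 ≤ f x) : μ.realIntegral f ∈ μ.integralPosCone := by
  have hm := μ.sup_mem_integrableFun hE hf (μ.zero_mem_integrableFun hE)
  refine μ.mem_integralPosCone.2 ⟨f ⊔ 0, hm, fun x => le_sup_right,
    μ.realIntegral_congr hm.1 hf.1 ?_⟩
  filter_upwards [h0] with x hx
  exact sup_eq_left.2 hx

theorem integralPosCone_nonneg {x : E} (hx : x ∈ μ.integralPosCone) : 0 ≤ x := by
  obtain ⟨f, hf, h0, rfl⟩ := μ.mem_integralPosCone.1 hx
  exact μ.realIntegral_nonneg hE hf (Eventually.of_forall h0)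

variable (hlat : PreservesLatticeStructure μ.integral)

include hlat

theorem isLUB_realIntegral_sup {f g : X → ℝ} (hf : f ∈ μ.IntegrableFun)
    (hg : g ∈ μ.IntegrableFun) :
    IsLUB {μ.realIntegral f, μ.realIntegral g} (μ.realIntegral (f ⊔ g)) := by
  refine hlat ⟨f, hf⟩ ⟨g, hg⟩ ⟨f ⊔ g, μ.sup_mem_integrableFun hE hf hg⟩ ⟨?_, fun b hb => ?_⟩
  · rintro _ (rfl | rfl)
    · exact le_sup_left (a := f)
    · exact le_sup_right (a := f)
  · exact sup_le (a := f) (hb (mem_insert _ _)) (hb (mem_insert_of_mem _ rfl))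

/-- The main use of the lattice hypothesis: by induction, the integral of f₀ ∨ … ∨ fₙ₊₁ is the least
upper bound of ∫ fₙ and ∫ fₙ₊₁, which is ∫ fₙ₊₁. -/
theorem realIntegral_partialSups {f : ℕ → X → ℝ} (hf : ∀ n, f n ∈ μ.IntegrableFun)
    (hm : Monotone fun n => μ.realIntegral (f n)) (n : ℕ) :
    μ.realIntegral (partialSups f n) = μ.realIntegral (f n) := by
  induction n with
  | zero => simp
  | succ n ih =>
    have h := μ.isLUB_realIntegral_sup hE hlat (partialSups_mem_of_closedUnder_max
      (fun f hf g hg => μ.sup_mem_integrableFun hE hf hg) hf n) (hf (n + 1))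
    rw [ih] at h
    rw [partialSups_add_one]
    refine h.unique ⟨?_, fun b hb => hb (mem_insert_of_mem _ rfl)⟩
    rintro _ (rfl | rfl)
    · exact hm n.le_succ
    · exact le_rfl

/-- Functions whose integrals increase need not increase themselves. Their partial suprema do and
have the same integrals, so monotone convergence applies to them. -/
theorem seqUp_integralPosCone_subset : seqUp μ.integralPosCone ⊆ μ.integralPosCone := by
  rintro x ⟨v, hv, hm, hx⟩
  have hv' := fun n => μ.mem_integralPosCone.1 (hv n)
  choose f hf hf0 hfv using hv'
  obtain rfl : v = fun n => μ.realIntegral (f n) := funext fun n => (hfv n).symm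
  have hp := μ.realIntegral_partialSups hE hlat hf hm
  simp only [← hp] at hx
  obtain ⟨g, hg, hgt, hgI⟩ := μ.exists_tendsto_of_monotone hE (f := fun n => partialSups f n)
    (fun n => partialSups_mem_of_closedUnder_max
      (fun f hf g hg => μ.sup_mem_integrableFun hE hf hg) hf n)
    (Eventually.of_forall fun x m n h => (partialSups f).monotone h x) ⟨x, hx.1⟩
  rw [hx.unique hgI]
  refine μ.realIntegral_mem_integralPosCone hE hg ?_
  filter_upwards [hgt] with y hy
  exact ge_of_tendsto' hy fun n => (hf0 n y).trans (le_partialSups f n y)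

theorem seqDown_integralPosCone_subset : seqDown μ.integralPosCone ⊆ μ.integralPosCone := by
  rintro x ⟨v, hv, hm, hx⟩
  have hv' := fun n => μ.mem_integralPosCone.1 (hv n)
  choose f hf hf0 hfv using hv'
  obtain rfl : v = fun n => μ.realIntegral (f n) := funext fun n => (hfv n).symm
  have hf' : ∀ n, -f n ∈ μ.IntegrableFun := fun n => μ.neg_mem_integrableFun (hf n)
  have hp := μ.realIntegral_partialSups hE hlat hf' fun m n h => by
    simpa only [realIntegral_neg] using neg_le_neg (hm h)
  -- These are the finite infima f₀ ∧ … ∧ fₙ, which remain nonnegative.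
  let k : ℕ → X → ℝ := fun n => -partialSups (fun n => -f n) n
  have hk : ∀ n, μ.realIntegral (k n) = μ.realIntegral (f n) := fun n => by
    rw [realIntegral_neg, hp, realIntegral_neg, neg_neg]
  simp only [← hk] at hx
  obtain ⟨g, hg, hgt, hgI⟩ := μ.exists_tendsto_of_antitone hE (f := k)
    (fun n => μ.neg_mem_integrableFun (partialSups_mem_of_closedUnder_max
      (fun f hf g hg => μ.sup_mem_integrableFun hE hf hg) hf' n))
    (Eventually.of_forall fun x m n h => neg_le_neg ((partialSups fun n => -f n).monotone h x)) ⟨x, hx.1⟩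
  rw [hx.unique hgI]
  refine μ.realIntegral_mem_integralPosCone hE hg ?_
  filter_upwards [hgt] with y hy
  refine ge_of_tendsto' hy fun n => ?_
  have : partialSups (fun n => -f n) n ≤ 0 :=
    partialSups_le _ _ _ fun j _ z => neg_nonpos.2 (hf0 j z)
  exact neg_nonneg.2 (this y)

theorem netUp_integralPosCone_subset (hcsp : HasCountableSupProperty E) :
    netUp μ.integralPosCone ⊆ μ.integralPosCone := by
  rintro x ⟨ι, _, _, hd, v, hv, hm, hx⟩
  obtain ⟨i, hi, hix⟩ := hcsp.exists_monotone_isLUB hd.directed hm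
    (fun a => μ.integralPosCone_nonneg hE (hv a)) hx
  exact μ.seqUp_integralPosCone_subset hE hlat ⟨_, fun n => hv _, fun m n h => hm (hi h), hix⟩

theorem netDown_integralPosCone_subset (hcsp : HasCountableSupProperty E) :
    netDown μ.integralPosCone ⊆ μ.integralPosCone := by
  rintro x ⟨ι, _, _, hd, v, hv, hm, hx⟩
  obtain ⟨i, hi, hix⟩ := hcsp.exists_antitone_isGLB (α := ιᵒᵈ)
    (m := fun a => v (OrderDual.ofDual a)) hd.directed (fun a b h => hm h) hx
  exact μ.seqDown_integralPosCone_subset hE hlat ⟨_, fun n => hv _, fun m n h => hm (hi h), hix⟩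

end PosCone

/-! ### Approximation by elementary functions -/

section Simple

variable {X : Type*} {E : Type u} [MeasurableSpace X] [AddCommGroup E] [PartialOrder E]
  [IsOrderedAddMonoid E] [Module ℝ E] (μ : OrderMeasure X E)

/-- The nonnegative integrable elementary functions. -/
def posSimple : Set (X → ℝ) :=
  {f | f ∈ μ.IntegrableFun ∧ ∃ φ : SimpleFunc X ℝ≥0, (fun x => (φ x : ℝ)) = f}

variable [IsOrderedModule ℝ E] (hE : IsMonotoneComplete E)

include hE

/-- An elementary function is a finite sum of multiples r·1_{φ = r}, so it suffices to treat
indicators of sets of finite measure. -/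
theorem posSimple_subset {C : Set (X → ℝ)} (hadd : ClosedUnder (fun a b => a + b) C)
    (hmul : ∀ r, 0 ≤ r → ClosedUnder (fun a _ => r * a) C)
    (hind : ∀ A, MeasurableSet A → μ A ≠ ⊤ → A.indicator (fun _ => (1 : ℝ)) ∈ C) :
    μ.posSimple ⊆ C := by
  classical
  rintro _ ⟨hφ, φ, rfl⟩
  have h0 : (fun _ => 0 : X → ℝ) ∈ C := by
    have := hind ∅ MeasurableSet.empty (by rw [μ.empty']; exact WithTop.zero_ne_top)
    simpa using this
  have key : ∀ s : Finset ℝ≥0,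
      (fun x => ∑ r ∈ s, (r : ℝ) * (φ ⁻¹' {r}).indicator (fun _ => (1 : ℝ)) x) ∈ C := by
    intro s
    induction s using Finset.induction_on with
    | empty => simpa using h0
    | insert r s hr ih =>
      simp only [Finset.sum_insert hr]
      refine hadd _ ?_ _ ih
      -- The zero set may have infinite measure, but its term vanishes. The other level sets have
      -- finite measure because `φ` is integrable.
      rcases eq_or_ne r 0 with rfl | hr0
      · simpa using h0
      · refine hmul r r.2 _ (hind _ (φ.measurableSet_fiber r) ?_) _ h0
        refine μ.measure_ne_top_of_indicator hE (φ.measurableSet_fiber r) hφ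
          (NNReal.coe_pos.2 (pos_iff_ne_zero.2 hr0)) fun x hx => ?_
        rw [show φ x = r from hx]
  convert key φ.range using 2 with x
  rw [Finset.sum_eq_single (φ x)]
  · simp
  · intro r _ hr
    rw [indicator_of_notMem, mul_zero]
    exact fun h => hr (Eq.symm h)
  · exact fun h => absurd (φ.mem_range_self x) h

theorem exists_posSimple_tendsto {f : X → ℝ} (hf : f ∈ μ.IntegrableFun) (h0 : ∀ x, 0 ≤ f x) :
    ∃ φ : ℕ → SimpleFunc X ℝ≥0, (∀ n x, (φ n x : ℝ) ≤ f x) ∧ Monotone φ ∧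
      (∀ n, (fun x => (φ n x : ℝ)) ∈ μ.IntegrableFun) ∧
      ∀ x, Tendsto (fun n => (φ n x : ℝ)) atTop (nhds (f x)) := by
  have hm := hf.1.ennreal_ofReal
  set F : X → ℝ≥0∞ := fun x => ENNReal.ofReal (f x) with hF
  have hle : ∀ n x, (((SimpleFunc.eapprox F n).map ENNReal.toNNReal x : ℝ≥0) : ℝ) ≤ f x :=
    fun n x => ENNReal.toReal_le_of_le_ofReal (h0 x)
      ((le_iSup (fun n => SimpleFunc.eapprox F n x) n).trans (SimpleFunc.iSup_eapprox_apply hm x).le)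
  refine ⟨fun n => (SimpleFunc.eapprox F n).map ENNReal.toNNReal, hle, fun m n h x =>
    ENNReal.toNNReal_mono (SimpleFunc.eapprox_lt_top F n x).ne (SimpleFunc.monotone_eapprox F h x),
    fun n => ?_, fun x => ?_⟩
  · refine μ.mem_integrableFun_of_abs_le hE hf (SimpleFunc.measurable _).coe_nnreal_real fun x => ?_
    rw [abs_of_nonneg (NNReal.coe_nonneg _), abs_of_nonneg (h0 x)]
    exact hle n x
  · have h1 := (ENNReal.tendsto_toReal (a := F x) ENNReal.ofReal_ne_top).comp
      (SimpleFunc.tendsto_eapprox hm x)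
    rw [ENNReal.toReal_ofReal (h0 x)] at h1
    exact h1

theorem mem_aeUp_posSimple {f : X → ℝ} (hf : f ∈ μ.IntegrableFun) (h0 : ∀ x, 0 ≤ f x) :
    f ∈ μ.aeUp μ.posSimple := by
  obtain ⟨φ, -, hm, hi, ht⟩ := μ.exists_posSimple_tendsto hE hf h0
  exact ⟨hf, fun n x => φ n x, fun n => ⟨hi n, φ n, rfl⟩,
    Eventually.of_forall fun x m n h => NNReal.coe_le_coe.2 (hm h x), Eventually.of_forall ht⟩

/-- If φₙ increases to M - f, then M - φₙ decreases to f. Finiteness of `μ` makes the constant `M`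
integrable. -/
theorem mem_aeDown_posSimple (hμ : μ.IsFinite) {f : X → ℝ} (hf : f ∈ μ.IntegrableFun)
    (h0 : ∀ x, 0 ≤ f x) {M : ℝ} (hM : ∀ x, f x ≤ M) : f ∈ μ.aeDown μ.posSimple := by
  -- Without a point, M ≥ 0 cannot be inferred.
  rcases isEmpty_or_nonempty X with hX | ⟨⟨x₀⟩⟩
  · exact μ.subset_aeDown (fun _ h => h.1) ⟨hf, 0, Subsingleton.elim _ _⟩
  have hM0 : 0 ≤ M := (h0 x₀).trans (hM x₀)
  have hc : (fun _ => M : X → ℝ) ∈ μ.IntegrableFun := by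
    simpa using μ.mul_mem_integrableFun hE M
      (μ.indicator_mem_integrableFun hE MeasurableSet.univ hμ)
  obtain ⟨φ, hle, hm, hi, ht⟩ := μ.exists_posSimple_tendsto hE
    (μ.sub_mem_integrableFun hE hc hf) fun x => sub_nonneg.2 (hM x)
  have hle' : ∀ n x, (φ n x : ℝ) ≤ M := fun n x =>
    (hle n x).trans (sub_le_self _ (h0 x))
  refine ⟨hf, fun n x => M - φ n x, fun n => ⟨μ.sub_mem_integrableFun hE hc (hi n),
    SimpleFunc.const X M.toNNReal - φ n, ?_⟩, Eventually.of_forall fun x m n h =>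
      sub_le_sub_left (NNReal.coe_le_coe.2 (hm h x)) _, Eventually.of_forall fun x => ?_⟩
  · ext x
    rw [SimpleFunc.coe_sub, Pi.sub_apply, SimpleFunc.const_apply, NNReal.coe_sub,
      Real.coe_toNNReal _ hM0]
    -- Since φₙ ≤ M, the truncated subtraction of elementary functions is the true one.
    exact NNReal.le_toNNReal_of_coe_le (hle' n x)
  · simpa using (ht x).const_sub M

end Simple

/-! ### Approximation by continuous functions with compact support -/

section PosCc

/-- The nonnegative continuous functions with compact support, as functions. -/
def posCc (X : Type*) [TopologicalSpace X] : Set (X → ℝ) := {g | ∃ f : C_c(X, ℝ), 0 ≤ f ∧ ⇑f = g}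

theorem closedUnder_posCc_add (X : Type*) [TopologicalSpace X] :
    ClosedUnder (fun a b => a + b) (posCc X) := by
  rintro _ ⟨f, hf, rfl⟩ _ ⟨g, hg, rfl⟩
  exact ⟨f + g, add_nonneg hf hg, rfl⟩

theorem closedUnder_posCc_mul (X : Type*) [TopologicalSpace X] {r : ℝ} (hr : 0 ≤ r) :
    ClosedUnder (fun a _ => r * a) (posCc X) := by
  rintro _ ⟨f, hf, rfl⟩ _ _
  exact ⟨r • f, fun x => mul_nonneg hr (hf x), rfl⟩

theorem closedUnder_posCc_max (X : Type*) [TopologicalSpace X] : ClosedUnder max (posCc X) := by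
  rintro _ ⟨f, hf, rfl⟩ _ ⟨g, hg, rfl⟩
  exact ⟨f ⊔ g, le_sup_of_le_left hf, rfl⟩

theorem closedUnder_posCc_min (X : Type*) [TopologicalSpace X] : ClosedUnder min (posCc X) := by
  rintro _ ⟨f, hf, rfl⟩ _ ⟨g, hg, rfl⟩
  exact ⟨f ⊓ g, le_inf hf hg, rfl⟩

end PosCc

section Represents

variable {X : Type*} {E : Type u} [TopologicalSpace X] [MeasurableSpace X] [AddCommGroup E]
  [PartialOrder E] [Module ℝ E] {μ : OrderMeasure X E} {T : C_c(X, ℝ) →ₗ[ℝ] E}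

theorem Represents.mem_integrableFun (hrep : μ.Represents T) (f : C_c(X, ℝ)) :
    (f : X → ℝ) ∈ μ.IntegrableFun := (hrep f).1

theorem Represents.realIntegral_eq (hrep : μ.Represents T) (f : C_c(X, ℝ)) :
    μ.realIntegral f = T f := (hrep f).2

theorem Represents.posCc_subset (hrep : μ.Represents T) : posCc X ⊆ μ.IntegrableFun := by
  rintro _ ⟨f, -, rfl⟩
  exact hrep.mem_integrableFun f

variable [IsOrderedAddMonoid E]

theorem posCcClasses_eq : μ.posCcClasses = μ.classes (posCc X) := by
  ext a
  constructor
  · rintro ⟨f, hf, ha⟩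
    exact ⟨f, ⟨f, hf, rfl⟩, ha⟩
  · rintro ⟨_, ⟨f, hf, rfl⟩, ha⟩
    exact ⟨f, hf, ha⟩

theorem Represents.image_posCcClasses_subset (hrep : μ.Represents T) :
    μ.integralL1 '' μ.posCcClasses ⊆ T '' {f | 0 ≤ f} := by
  rintro _ ⟨a, ⟨f, hf, ha⟩, rfl⟩
  exact ⟨f, hf, by rw [μ.integralL1_eq a (hrep.mem_integrableFun f) ha, hrep.realIntegral_eq]⟩

variable [IsOrderedModule ℝ E]

theorem Represents.image_pos_subset (hE : IsMonotoneComplete E) (hrep : μ.Represents T) :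
    T '' {f | 0 ≤ f} ⊆ μ.integralPosCone := by
  rintro _ ⟨f, hf, rfl⟩
  rw [← hrep.realIntegral_eq]
  exact μ.realIntegral_mem_integralPosCone hE (hrep.mem_integrableFun f) (Eventually.of_forall hf)

theorem Represents.mono (hE : IsMonotoneComplete E) (hrep : μ.Represents T) {f g : C_c(X, ℝ)}
    (h : f ≤ g) : T f ≤ T g := by
  rw [← hrep.realIntegral_eq, ← hrep.realIntegral_eq]
  exact μ.realIntegral_mono hE (hrep.mem_integrableFun f) (hrep.mem_integrableFun g)
    (Eventually.of_forall h)

variable [BorelSpace X] (hE : IsMonotoneComplete E) (hcsp : HasCountableSupProperty E)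

include hE hcsp

/-- The functions f ≺ V are directed under ∨, so the countable sup property extracts an increasing
sequence with integrals having supremum μ(V). It lies below 1_V, whose integral is μ(V), and so
converges to 1_V almost everywhere. -/
theorem Represents.indicator_isOpen_mem_aeUp (hrep : μ.Represents T) {V : Set X} (hV : IsOpen V)
    (hfin : μ V ≠ ⊤)
    (h : ∃ e : E, μ V = e ∧ IsLUB {y | ∃ f, SubordinateToOpen f V ∧ T f = y} e) :
    V.indicator (fun _ => (1 : ℝ)) ∈ μ.aeUp (posCc X) := by
  obtain ⟨e, he, hL⟩ := h
  let α := {f : C_c(X, ℝ) // SubordinateToOpen f V}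
  have : Nonempty α := ⟨⟨0, fun x => ⟨le_rfl, zero_le_one⟩, by simp⟩⟩
  have hr : {y | ∃ f, SubordinateToOpen f V ∧ T f = y} = range fun f : α => T f.1 := by
    ext y
    simp [α]
  rw [hr] at hL
  obtain ⟨i, hi, hiL⟩ := hcsp.exists_monotone_isLUB (α := α)
    (by
      rintro ⟨f, hf, hfV⟩ ⟨g, hg, hgV⟩
      refine ⟨⟨f ⊔ g, fun x => ⟨le_sup_of_le_left (hf x).1, sup_le (hf x).2 (hg x).2⟩, ?_⟩,
        le_sup_left (a := f), le_sup_right (a := f)⟩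
      -- The support of f ∨ g is contained in the union of the two supports.
      refine Subset.trans ?_ (union_subset hfV hgV)
      rw [tsupport, tsupport, tsupport, ← closure_union]
      refine closure_mono fun x hx => ?_
      by_contra hn
      simp only [mem_union, Function.mem_support, not_or, not_not] at hn
      exact hx (by simp [hn.1, hn.2]))
    (fun f g h => hrep.mono hE h)
    (fun f => by
      rw [← map_zero T]
      exact hrep.mono hE fun x => (f.2.1 x).1) hL
  have hV1 := μ.indicator_mem_integrableFun hE hV.measurableSet hfin
  have hI := μ.coe_realIntegral_indicator hE hV.measurableSet hfin
  rw [he] at hI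
  refine ⟨hV1, fun n => (i n).1, fun n => ⟨(i n).1, fun x => ((i n).2.1 x).1, rfl⟩, ?_, ?_⟩
  · exact Eventually.of_forall fun x m n h => hi h x
  · refine μ.tendsto_of_isLUB hE (fun n => hrep.mem_integrableFun _)
      (Eventually.of_forall fun x m n h => hi h x) hV1 (fun n => Eventually.of_forall fun x => ?_) ?_
    · by_cases hx : x ∈ V
      · rw [indicator_of_mem hx]
        exact ((i n).2.1 x).2
      · rw [indicator_of_notMem hx, image_eq_zero_of_notMem_tsupport fun h => hx ((i n).2.2 h)]
    · rw [WithTop.coe_injective hI]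
      simpa only [hrep.realIntegral_eq] using hiL

theorem Represents.indicator_isCompact_mem_aeDown [T2Space X] [LocallyCompactSpace X]
    (hrep : μ.Represents T) {K : Set X} (hK : IsCompact K)
    (h : ∃ e : E, μ K = e ∧ IsGLB {y | ∃ f, DominatesCompact K f ∧ T f = y} e) :
    K.indicator (fun _ => (1 : ℝ)) ∈ μ.aeDown (posCc X) := by
  obtain ⟨e, he, hL⟩ := h
  have hfin : μ K ≠ ⊤ := he ▸ WithTop.coe_ne_top
  let α := {f : C_c(X, ℝ) // DominatesCompact K f}
  have : Nonempty α := by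
    -- Urysohn's lemma supplies at least one f with K ≺ f.
    obtain ⟨f, hf1, -, hfc, hf⟩ := exists_continuous_one_zero_of_isCompact hK isClosed_empty
      (disjoint_empty K)
    exact ⟨⟨⟨f, hfc⟩, fun x => hf x, fun x hx => hf1 hx⟩⟩
  have hr : {y | ∃ f, DominatesCompact K f ∧ T f = y} = range fun f : α => T f.1 := by
    ext y
    simp [α]
  rw [hr] at hL
  obtain ⟨i, hi, hiL⟩ := hcsp.exists_antitone_isGLB (α := α)
    (by
      rintro ⟨f, hf, hfK⟩ ⟨g, hg, hgK⟩
      exact ⟨⟨f ⊓ g, fun x => ⟨le_inf (hf x).1 (hg x).1, inf_le_of_left_le (hf x).2⟩,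
        fun x hx => by simp [hfK x hx, hgK x hx]⟩, inf_le_left (a := f), inf_le_right (a := f)⟩)
    (fun f g h => hrep.mono hE h) hL
  have hK1 := μ.indicator_mem_integrableFun hE hK.measurableSet hfin
  have hI := μ.coe_realIntegral_indicator hE hK.measurableSet hfin
  rw [he] at hI
  refine ⟨hK1, fun n => (i n).1, fun n => ⟨(i n).1, fun x => ((i n).2.1 x).1, rfl⟩, ?_, ?_⟩
  · exact Eventually.of_forall fun x m n h => hi h x
  · refine μ.tendsto_of_isGLB hE (fun n => hrep.mem_integrableFun _)
      (Eventually.of_forall fun x m n h => hi h x) hK1 (fun n => Eventually.of_forall fun x => ?_) ?_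
    · by_cases hx : x ∈ K
      · rw [indicator_of_mem hx, (i n).2.2 x hx]
      · rw [indicator_of_notMem hx]
        exact ((i n).2.1 x).1
    · rw [WithTop.coe_injective hI]
      simpa only [hrep.realIntegral_eq] using hiL

/-- The open sets containing `A` are directed downwards under intersection. Those of infinite
measure do not affect the infimum in E ∪ {∞}, and dropping them moves the problem to `E`, where a
decreasing sequence can be extracted. -/
theorem OuterRegularAt.indicator_mem_aeDown {A : Set X} (hA : MeasurableSet A) (hfin : μ A ≠ ⊤)
    (h : μ.OuterRegularAt A) {C : Set (X → ℝ)}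
    (hC : ∀ V, IsOpen V → μ V ≠ ⊤ → V.indicator (fun _ => (1 : ℝ)) ∈ C) :
    A.indicator (fun _ => (1 : ℝ)) ∈ μ.aeDown C := by
  let α := {V : Set X // (IsOpen V ∧ A ⊆ V) ∧ μ V ≠ ⊤}
  have : Nonempty α := by
    -- If all open sets containing `A` had infinite measure, outer regularity would give μ(A) = ∞.
    by_contra hn
    refine hfin (top_le_iff.1 (h.2 ?_))
    rintro _ ⟨V, hV, hAV, rfl⟩
    by_contra hV'
    exact hn ⟨⟨V, ⟨hV, hAV⟩, fun h => hV' h.ge⟩⟩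
  have hm : ∀ {V W : Set X}, IsOpen V → IsOpen W → V ⊆ W → μ V ≤ μ W := fun hV hW h =>
    μ.mono hV.measurableSet hW.measurableSet h
  let J : Set X → E := fun V => μ.realIntegral (V.indicator fun _ => (1 : ℝ))
  have hJ : ∀ {V : Set X}, MeasurableSet V → μ V ≠ ⊤ → (J V : WithTop E) = μ V :=
    fun hV hf => μ.coe_realIntegral_indicator hE hV hf
  have hL : IsGLB (range fun V : α => J V.1) (J A) := by
    refine ⟨?_, fun b hb => ?_⟩
    · rintro _ ⟨⟨V, ⟨hV, hAV⟩, hVf⟩, rfl⟩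
      rw [← WithTop.coe_le_coe, hJ hA hfin, hJ hV.measurableSet hVf]
      exact μ.mono hA hV.measurableSet hAV
    · rw [← WithTop.coe_le_coe, hJ hA hfin]
      refine h.2 ?_
      rintro _ ⟨V, hV, hAV, rfl⟩
      by_cases hVf : μ V = ⊤
      · rw [hVf]
        exact le_top
      · rw [← hJ hV.measurableSet hVf]
        exact WithTop.coe_le_coe.2 (hb ⟨⟨V, ⟨hV, hAV⟩, hVf⟩, rfl⟩)
  obtain ⟨i, hi, hiL⟩ := hcsp.exists_antitone_isGLB (α := α)
    (by
      rintro ⟨V, ⟨hV, hAV⟩, hVf⟩ ⟨W, ⟨hW, hAW⟩, hWf⟩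
      exact ⟨⟨V ∩ W, ⟨hV.inter hW, subset_inter hAV hAW⟩, ((hm (hV.inter hW) hV
        inter_subset_left).trans_lt hVf.lt_top).ne⟩, inter_subset_left, inter_subset_right⟩)
    (fun V W h => by
      rw [← WithTop.coe_le_coe, hJ V.2.1.1.measurableSet V.2.2, hJ W.2.1.1.measurableSet W.2.2]
      exact hm V.2.1.1 W.2.1.1 h) hL
  have hA1 := μ.indicator_mem_integrableFun hE hA hfin
  have ha : ∀ᶠ x in μ.ae, Antitone fun n => (i n).1.indicator (fun _ => (1 : ℝ)) x :=
    Eventually.of_forall fun x m n h => indicator_one_mono (hi h) x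
  exact ⟨hA1, fun n => (i n).1.indicator fun _ => 1, fun n => hC _ (i n).2.1.1 (i n).2.2, ha,
    μ.tendsto_of_isGLB hE
      (fun n => μ.indicator_mem_integrableFun hE (i n).2.1.1.measurableSet (i n).2.2) ha hA1
      (fun n => Eventually.of_forall fun x => indicator_one_mono (i n).2.1.2 x) hiL⟩

/-- Compact subsets of `A` are directed upwards under union, and all have finite measure because `A`
has. -/
theorem InnerRegularAt.indicator_mem_aeUp [T2Space X] {A : Set X} (hA : MeasurableSet A)
    (hfin : μ A ≠ ⊤) (h : μ.InnerRegularAt A) {C : Set (X → ℝ)}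
    (hC : ∀ K, IsCompact K → K.indicator (fun _ => (1 : ℝ)) ∈ C) :
    A.indicator (fun _ => (1 : ℝ)) ∈ μ.aeUp C := by
  let α := {K : Set X // IsCompact K ∧ K ⊆ A}
  have : Nonempty α := ⟨⟨∅, isCompact_empty, empty_subset A⟩⟩
  let J : Set X → E := fun V => μ.realIntegral (V.indicator fun _ => (1 : ℝ))
  have hJ : ∀ {V : Set X}, MeasurableSet V → μ V ≠ ⊤ → (J V : WithTop E) = μ V :=
    fun hV hf => μ.coe_realIntegral_indicator hE hV hf
  have hKf : ∀ K : α, μ K.1 ≠ ⊤ := fun K =>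
    ((μ.mono K.2.1.measurableSet hA K.2.2).trans_lt hfin.lt_top).ne
  have hL : IsLUB (range fun K : α => J K.1) (J A) := by
    refine ⟨?_, fun b hb => ?_⟩
    · rintro _ ⟨K, rfl⟩
      rw [← WithTop.coe_le_coe, hJ hA hfin, hJ K.2.1.measurableSet (hKf K)]
      exact μ.mono K.2.1.measurableSet hA K.2.2
    · rw [← WithTop.coe_le_coe, hJ hA hfin]
      refine h.2 ?_
      rintro _ ⟨K, hK, hKA, rfl⟩
      rw [← hJ hK.measurableSet (hKf ⟨K, hK, hKA⟩)]
      exact WithTop.coe_le_coe.2 (hb ⟨⟨K, hK, hKA⟩, rfl⟩)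
  obtain ⟨i, hi, hiL⟩ := hcsp.exists_monotone_isLUB (α := α)
    (by
      rintro ⟨K, hK, hKA⟩ ⟨L, hL, hLA⟩
      exact ⟨⟨K ∪ L, hK.union hL, union_subset hKA hLA⟩, subset_union_left, subset_union_right⟩)
    (fun K L h => by
      rw [← WithTop.coe_le_coe, hJ K.2.1.measurableSet (hKf K), hJ L.2.1.measurableSet (hKf L)]
      exact μ.mono K.2.1.measurableSet L.2.1.measurableSet h)
    (fun K => by
      rw [← WithTop.coe_le_coe, hJ K.2.1.measurableSet (hKf K)]
      exact μ.nonneg' _ K.2.1.measurableSet) hL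
  have hA1 := μ.indicator_mem_integrableFun hE hA hfin
  have ha : ∀ᶠ x in μ.ae, Monotone fun n => (i n).1.indicator (fun _ => (1 : ℝ)) x :=
    Eventually.of_forall fun x m n h => indicator_one_mono (hi h) x
  exact ⟨hA1, fun n => (i n).1.indicator fun _ => 1, fun n => hC _ (i n).2.1, ha,
    μ.tendsto_of_isLUB hE
      (fun n => μ.indicator_mem_integrableFun hE (i n).2.1.measurableSet (hKf _)) ha hA1
      (fun n => Eventually.of_forall fun x => indicator_one_mono (i n).2.2 x) hiL⟩

end Represents

/-! ### Stability of ups and downs under pointwise operations -/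

section Stability

variable {X : Type*} {E : Type u} [MeasurableSpace X] [AddCommGroup E] [PartialOrder E]
  [IsOrderedAddMonoid E] [Module ℝ E] [IsOrderedModule ℝ E] (μ : OrderMeasure X E)
  (hE : IsMonotoneComplete E) {S : Set (X → ℝ)}

include hE

theorem closedUnder_ups_downs_add (hS : ClosedUnder (fun a b => a + b) S) :
    ClosedUnder (fun a b => a + b) (μ.aeUp S) ∧ ClosedUnder (fun a b => a + b) (μ.aeDown S) := by
  have hi : ClosedUnder (fun a b => a + b) μ.IntegrableFun :=
    fun f hf g hg => μ.add_mem_integrableFun hE hf hg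
  exact ⟨μ.closedUnder_aeUp continuous_add (fun _ _ _ _ => add_le_add) hi hS,
    μ.closedUnder_aeDown continuous_add (fun _ _ _ _ => add_le_add) hi hS⟩

theorem closedUnder_ups_downs_mul {r : ℝ} (hr : 0 ≤ r) (hS : ClosedUnder (fun a _ => r * a) S) :
    ClosedUnder (fun a _ => r * a) (μ.aeUp S) ∧ ClosedUnder (fun a _ => r * a) (μ.aeDown S) := by
  have hi : ClosedUnder (fun a _ => r * a) μ.IntegrableFun :=
    fun f hf _ _ => μ.mul_mem_integrableFun hE r hf
  have hc : Continuous fun p : ℝ × ℝ => r * p.1 := continuous_const.mul continuous_fst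
  exact ⟨μ.closedUnder_aeUp hc (fun _ _ _ _ h _ => mul_le_mul_of_nonneg_left h hr) hi hS,
    μ.closedUnder_aeDown hc (fun _ _ _ _ h _ => mul_le_mul_of_nonneg_left h hr) hi hS⟩

theorem closedUnder_max_aeDown (hS : ClosedUnder max S) : ClosedUnder max (μ.aeDown S) :=
  μ.closedUnder_aeDown continuous_max (fun _ _ _ _ => max_le_max)
    (fun _ hf _ hg => μ.sup_mem_integrableFun hE hf hg) hS

theorem closedUnder_min_aeUp (hS : ClosedUnder min S) : ClosedUnder min (μ.aeUp S) :=
  μ.closedUnder_aeUp continuous_min (fun _ _ _ _ => min_le_min)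
    (fun _ hf _ hg => μ.inf_mem_integrableFun hE hf hg) hS

end Stability

end OrderMeasure

end

/-! ### The main theorem -/

open OrderMeasure in
theorem mainTheorem6 {X E : Type*}
    [TopologicalSpace X] [LocallyCompactSpace X] [T2Space X] [MeasurableSpace X] [BorelSpace X]
    [AddCommGroup E] [PartialOrder E] [IsOrderedAddMonoid E] [Module ℝ E] [IsOrderedModule ℝ E]
    (hE : IsMonotoneComplete E)
    (hcsp : HasCountableSupProperty E)
    (T : C_c(X, ℝ) →ₗ[ℝ] E) (hT : ∀ f, 0 ≤ f → 0 ≤ T f)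
    (μ : OrderMeasure X E) (hμ : μ.IsRegularBorel) (hrep : μ.Represents T)
    (hopen : ∀ V : Set X, IsOpen V → μ V ≠ ⊤ →
      ∃ e : E, μ V = e ∧ IsLUB {y | ∃ f, SubordinateToOpen f V ∧ T f = y} e)
    (hcompact : ∀ K : Set X, IsCompact K →
      ∃ e : E, μ K = e ∧ IsGLB {y | ∃ f, DominatesCompact K f ∧ T f = y} e)
    (hlat : PreservesLatticeStructure μ.integral) :
    -- the image of the positive cone is closed under ups and downs, and is an up-down-up
    ((μ.integralPosCone = netUp μ.integralPosCone ∧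
        μ.integralPosCone = netDown μ.integralPosCone) ∧
      (μ.integralPosCone = μ.integralL1 '' seqUp (seqDown (seqUp μ.posCcClasses)) ∧
        μ.integralPosCone = seqUp (seqDown (seqUp (T '' {f | 0 ≤ f}))))) ∧
    -- the case of inner regularity at the Borel sets of finite measure
    ((∀ A : Set X, MeasurableSet A → μ A ≠ ⊤ → μ.InnerRegularAt A) →
      (μ.integralPosCone = μ.integralL1 '' seqDown (seqUp (seqDown μ.posCcClasses)) ∧
        μ.integralPosCone = seqDown (seqUp (seqDown (T '' {f | 0 ≤ f})))) ∧
      (μ.integralPosCone = μ.integralL1 '' seqUp (seqDown μ.posCcClasses) ∧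
        μ.integralPosCone = seqUp (seqDown (T '' {f | 0 ≤ f})))) ∧
    -- the case of a finite measure for which all integrable functions are essentially bounded
    (μ.IsFinite → μ.L1 = μ.BoundedClasses →
      (μ.integralPosCone = μ.integralL1 '' seqDown (seqUp μ.posCcClasses) ∧
        μ.integralPosCone = seqDown (seqUp (T '' {f | 0 ≤ f})))) := by
  have hup := μ.image_integralL1_seqUp_subset hE
  have hdown := μ.image_integralL1_seqDown_subset hE
  have hPup := μ.seqUp_integralPosCone_subset hE hlat
  have hPdown := μ.seqDown_integralPosCone_subset hE hlat
  have hTP := hrep.image_pos_subset hE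
  have hcT := hrep.image_posCcClasses_subset
  have hcls : ∀ {f : X → ℝ} {Z : Set (X → ℝ)}, f ∈ μ.IntegrableFun → f ∈ Z →
      μ.realIntegral f ∈ μ.integralL1 '' μ.classes Z := fun {f Z} hf hZ =>
    ⟨⟨f, f, hf, rfl⟩, ⟨f, hZ, rfl⟩, μ.integralL1_eq _ hf rfl⟩
  have squeeze : ∀ {A B C : Set E}, A ⊆ B → B ⊆ C → C ⊆ A → A = B ∧ A = C :=
    fun h1 h2 h3 => ⟨h1.antisymm (h2.trans h3), (h1.trans h2).antisymm h3⟩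
  have hU : ∀ V, IsOpen V → μ V ≠ ⊤ → V.indicator (fun _ => (1 : ℝ)) ∈ μ.aeUp (posCc X) :=
    fun V hV hf => hrep.indicator_isOpen_mem_aeUp hE hcsp hV hf (hopen V hV hf)
  -- Indicators of open sets are ups, so outer regularity makes the other indicators of finite
  -- measure, and with them the elementary functions, up-downs.
  have hS1 : μ.posSimple ⊆ μ.aeDown (μ.aeUp (posCc X)) :=
    μ.posSimple_subset hE
      (μ.closedUnder_ups_downs_add hE (μ.closedUnder_ups_downs_add hE
        (closedUnder_posCc_add X)).1).2
      (fun r hr => (μ.closedUnder_ups_downs_mul hE hr (μ.closedUnder_ups_downs_mul hE hr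
        (closedUnder_posCc_mul X hr)).1).2)
      (fun A hA hf => (hμ.outer_borel A hA).indicator_mem_aeDown hE hcsp hA hf hU)
  have hD0 := hrep.posCc_subset
  refine ⟨⟨⟨(subset_netUp _).antisymm (μ.netUp_integralPosCone_subset hE hlat hcsp),
    (subset_netDown _).antisymm (μ.netDown_integralPosCone_subset hE hlat hcsp)⟩, ?_⟩, ?_, ?_⟩
  · refine squeeze ?_ ?_ ?_
    · intro y hy
      obtain ⟨f, hf, h0, rfl⟩ := μ.mem_integralPosCone.1 hy
      refine image_mono ?_ (hcls hf (μ.aeUp_mono hS1 (μ.mem_aeUp_posSimple hE hf h0)))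
      rw [posCcClasses_eq]
      exact (μ.classes_aeUp_subset (μ.aeDown_subset _)).trans (seqUp_mono
        ((μ.classes_aeDown_subset (μ.aeUp_subset _)).trans
          (seqDown_mono (μ.classes_aeUp_subset hD0))))
    · exact (hup _).trans (seqUp_mono ((hdown _).trans (seqDown_mono
        ((hup _).trans (seqUp_mono hcT)))))
    · exact (seqUp_mono ((seqDown_mono ((seqUp_mono hTP).trans hPup)).trans hPdown)).trans hPup
  · intro hinner
    have hK : ∀ K, IsCompact K → K.indicator (fun _ => (1 : ℝ)) ∈ μ.aeDown (posCc X) :=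
      fun K hK => hrep.indicator_isCompact_mem_aeDown hE hcsp hK (hcompact K hK)
    have hS2 : μ.posSimple ⊆ μ.aeUp (μ.aeDown (posCc X)) :=
      μ.posSimple_subset hE
        (μ.closedUnder_ups_downs_add hE (μ.closedUnder_ups_downs_add hE
          (closedUnder_posCc_add X)).2).1
        (fun r hr => (μ.closedUnder_ups_downs_mul hE hr (μ.closedUnder_ups_downs_mul hE hr
          (closedUnder_posCc_mul X hr)).2).1)
        (fun A hA hf => (hinner A hA hf).indicator_mem_aeUp hE hcsp hA hf hK)
    have h1 : μ.integralPosCone ⊆ μ.integralL1 '' seqUp (seqDown μ.posCcClasses) := by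
      intro y hy
      obtain ⟨f, hf, h0, rfl⟩ := μ.mem_integralPosCone.1 hy
      -- A priori `f` is a down-up-up; stability of the downs under max merges the two ups.
      refine image_mono ?_ (hcls hf (μ.aeUp_aeUp_subset
        (μ.closedUnder_max_aeDown hE (closedUnder_posCc_max X))
        (μ.aeUp_mono hS2 (μ.mem_aeUp_posSimple hE hf h0))))
      rw [posCcClasses_eq]
      exact (μ.classes_aeUp_subset (μ.aeDown_subset _)).trans
        (seqUp_mono (μ.classes_aeDown_subset hD0))
    have h2 : μ.integralL1 '' seqUp (seqDown μ.posCcClasses) ⊆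
        seqUp (seqDown (T '' {f | 0 ≤ f})) :=
      (hup _).trans (seqUp_mono ((hdown _).trans (seqDown_mono hcT)))
    have h3 : seqUp (seqDown (T '' {f | 0 ≤ f})) ⊆ μ.integralPosCone :=
      (seqUp_mono ((seqDown_mono hTP).trans hPdown)).trans hPup
    -- The statement for ↓↑↓ follows from that for ↓↑: a further down only enlarges the sets, and
    -- `integralPosCone` is closed under it.
    exact ⟨squeeze (h1.trans (image_mono (subset_seqDown _))) ((hdown _).trans (seqDown_mono h2))
      ((seqDown_mono h3).trans hPdown), squeeze h1 h2 h3⟩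
  · intro hfin hB
    refine squeeze ?_ ((hdown _).trans (seqDown_mono ((hup _).trans (seqUp_mono hcT))))
      ((seqDown_mono ((seqUp_mono hTP).trans hPup)).trans hPdown)
    intro y hy
    obtain ⟨f, hf, h0, rfl⟩ := μ.mem_integralPosCone.1 hy
    have hfB : (f : Germ μ.ae ℝ) ∈ μ.BoundedClasses := hB ▸ ⟨f, hf, rfl⟩
    obtain ⟨g, ⟨hg, M, hM⟩, hgf⟩ := hfB
    have hgf : g =ᶠ[μ.ae] f := Germ.coe_eq.1 hgf
    -- The function `f` is only essentially bounded. Truncation at `M` makes it bounded everywhere,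
    -- changes it on a null set only, and keeps it nonnegative since M ≥ |g| ≥ 0.
    let h : X → ℝ := fun x => min (f x) M
    have hh0 : ∀ x, 0 ≤ h x := fun x => le_min (h0 x) ((abs_nonneg _).trans (hM x))
    have hh : h ∈ μ.IntegrableFun := by
      refine μ.mem_integrableFun_of_abs_le hE hf (hf.1.min measurable_const) fun x => ?_
      rw [abs_of_nonneg (hh0 x), abs_of_nonneg (h0 x)]
      exact min_le_left _ _
    have hhf : h =ᶠ[μ.ae] f := by
      filter_upwards [hgf] with x hx
      exact min_eq_left (hx ▸ (le_abs_self _).trans (hM x))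
    rw [← μ.realIntegral_congr hh.1 hf.1 hhf]
    -- A priori `h` is an up-down-down; stability of the ups under min merges the two downs.
    refine image_mono ?_ (hcls hh (μ.aeDown_aeDown_subset
      (μ.closedUnder_min_aeUp hE (closedUnder_posCc_min X))
      (μ.aeDown_mono hS1 (μ.mem_aeDown_posSimple hE hfin hh hh0 fun x => min_le_right _ _))))
    rw [posCcClasses_eq]
    exact (μ.classes_aeDown_subset (μ.aeUp_subset _)).trans
      (seqDown_mono (μ.classes_aeUp_subset hD0))
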